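/- Let $\mathcal P$ be a set of pairwise distinct prime numbers with $2\notin\mathcal P$, and let $K=\prod_{q\in\mathcal P}X_q$ (product topology), where each $X_q$ is either a finite cyclic $q$-group $\mathbb Z(q^{k_q})$ or the group $\mathbb Z_q$ of $q$-adic integers. Let $p\neq 2$ be a prime with $p\notin\mathcal P$, let $\mathbb Z(p^\infty)=\{k/p^n \bmod 1\}$ be the discrete $p$-quasicyclic group, and let $X=K\times\mathbb Z(p^\infty)$. Let $\alpha$ be an arbitrary topological automorphism of $X$; it maps $\{0\}\times\mathbb Z(p^\infty)$ onto itself, and $\alpha_{\mathbb Z(p^\infty)}$ denotes its restriction to $\mathbb Z(p^\infty)$. Let $\xi_1,\xi_2$ be independent random variables with values in $X$ and distributions (Borel probability measures) $\mu_1,\mu_2$. Assume that the conditional distribution of $L_2=\xi_1+\alpha\xi_2$ given $L_1=\xi_1+\xi_2$ is symmetric, i.e. $(L_1,L_2)$ and $(L_1,-L_2)$ are identically distributed. Then there are a closed subgroup $G$ of $X$ with $\alpha(G)=G$, $(I-\alpha)(G)=G$ and $(I+\alpha)(G)$ compact, where $I$ is the identity automorphism, and a distribution $\lambda$ on $X$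 supported in $G$ such that: (i) $\mu_1$ and $\mu_2$ are shifts of $\lambda$, i.e. $\mu_j=\lambda*\delta_{x_j}$ for some $x_j\in X$, $j=1,2$; (ii) $G$ is the smallest closed subgroup of $X$ containing the support of $\lambda$; (iii) the Haar distribution $m_{(I+\alpha)(G)}$ (the normalized Haar measure of the compact group $(I+\alpha)(G)$, viewed as a distribution on $X$) is a factor of $\lambda$, i.e. $\lambda=m_{(I+\alpha)(G)}*\rho$ for some distribution $\rho$ on $X$; (iv) if $\eta_1,\eta_2$ are independent identically distributed random variables with values in $G$ and distribution $\lambda$, then the conditional distribution of $M_2=\eta_1+\alpha_G\eta_2$ given $M_1=\eta_1+\eta_2$ is symmetric, where $\alpha_G$ is the restriction of $\alpha$ to $G$. Moreover, if $\alpha_{\mathbb Z(p^\infty)}\neq -I$, then $G$ is compact; and if $\alpha_{\mathbb Z(p^\infty)}=-I$, then either $G$ is compact or $G=M\times\mathbb Z(p^\infty)$, where $M$ is a compact subgroup of $K$. -/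

import Mathlib

open MeasureTheory ProbabilityTheory
open scoped MeasureTheory

universe u v w

noncomputable section

namespace HeydeQuasicyclic

/-! ### The groups -/

/-- `G` is topologically isomorphic to a finite cyclic group `ℤ(q ^ k)` (with the discrete topology)
or to the group `ℤ_q` of `q`-adic integers. -/
def IsCyclicOrPadic (q : ℕ) (G : Type*) [AddCommGroup G] [TopologicalSpace G] : Prop :=
  (∃ k : ℕ, Nonempty (G ≃ₜ+ ZMod (q ^ k))) ∨ ∃ _ : Fact q.Prime, Nonempty (G ≃ₜ+ ℤ_[q])

/-- The elements of `ℚ / ℤ` that are killed by a power of `p`; for `p ≠ 0` these are the classes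
of the fractions `k / p ^ n`. -/
def quasicyclicSubgroup (p : ℕ) : AddSubgroup (ℚ ⧸ AddSubgroup.zmultiples (1 : ℚ)) where
  carrier := {x | ∃ n : ℕ, p ^ n • x = 0}
  zero_mem' := ⟨0, by simp⟩
  add_mem' := by
    rintro x y ⟨m, hm⟩ ⟨n, hn⟩
    refine ⟨m + n, ?_⟩
    rw [smul_add, pow_add, mul_smul, mul_smul, hn, smul_zero, add_zero, smul_comm, hm, smul_zero]
  neg_mem' := by
    rintro x ⟨n, hn⟩
    exact ⟨n, by rw [smul_neg, hn, neg_zero]⟩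

/-- The `p`-quasicyclic group `ℤ(p^∞)`: the fractions `k / p ^ n` under addition modulo 1. -/
def Quasicyclic (p : ℕ) : Type := quasicyclicSubgroup p

instance (p : ℕ) : AddCommGroup (Quasicyclic p) :=
  inferInstanceAs (AddCommGroup (quasicyclicSubgroup p))

/-- `ℤ(p^∞)` carries the discrete topology. -/
instance (p : ℕ) : TopologicalSpace (Quasicyclic p) := ⊥

instance (p : ℕ) : DiscreteTopology (Quasicyclic p) := ⟨rfl⟩

/-- The group `X = K × ℤ(p^∞)`, where `K` is the direct product of the groups `F q`, `q ∈ P`, with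
the product topology. -/
abbrev ProductGroup {P : Set ℕ} (F : P → Type u) (p : ℕ) : Type u :=
  (∀ q, F q) × Quasicyclic p

section General

variable {X : Type*} [AddCommGroup X] [TopologicalSpace X]

/-- The restriction `α_G` of a topological automorphism `α` to a subgroup `G` with `α(G) = G`. -/
def restrictAut (α : X ≃ₜ+ X) (G : AddSubgroup X)
    (hG : G.map (α : X →+ X) = G) : G ≃ₜ+ G where
  toFun g := ⟨α g, by
    have h : α (g : X) ∈ G.map (α : X →+ X) := ⟨g, g.2, rfl⟩
    rwa [hG] at h⟩
  invFun g := ⟨α.symm g, by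
    obtain ⟨x, hx, hxg⟩ : (g : X) ∈ G.map (α : X →+ X) := hG.symm ▸ g.2
    have hxg' : α x = (g : X) := hxg
    rw [← hxg', α.symm_apply_apply]
    exact hx⟩
  left_inv g := Subtype.ext (α.symm_apply_apply g)
  right_inv g := Subtype.ext (α.apply_symm_apply g)
  map_add' g h := Subtype.ext (map_add α (g : X) h)
  continuous_toFun := by
    exact Continuous.subtype_mk (α.continuous_toFun.comp continuous_subtype_val) _
  continuous_invFun := by
    exact Continuous.subtype_mk (α.continuous_invFun.comp continuous_subtype_val) _

/-- The endomorphism `I - α`. -/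
def idSub (α : X ≃ₜ+ X) : X →+ X := AddMonoidHom.id X - (α : X →+ X)

/-- The endomorphism `I + α`. -/
def idAdd (α : X ≃ₜ+ X) : X →+ X := AddMonoidHom.id X + (α : X →+ X)

end General

/-! ### Distributions -/

section Distributions

variable {X : Type*} [AddCommGroup X] [TopologicalSpace X] [MeasurableSpace X]

/-- The conditional distribution of `η` given `ξ` is symmetric: the random vectors `(ξ, η)` and
`(ξ, -η)` are identically distributed. -/
def CondSymmetric {Ω : Type*} [MeasurableSpace Ω] (ξ η : Ω → X) (Pr : Measure Ω) : Prop :=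
  IdentDistrib (fun ω => (ξ ω, η ω)) (fun ω => (ξ ω, -η ω)) Pr Pr

/-- `μ` is a shift of `lam`: it is the convolution of `lam` with a degenerate distribution. -/
def IsShift (μ lam : Measure X) : Prop := ∃ x : X, μ = lam ∗ Measure.dirac x

/-- `ν` is a factor of `lam`: `lam` is the convolution of `ν` with some distribution. -/
def IsFactor (ν lam : Measure X) : Prop :=
  ∃ ρ : Measure X, IsProbabilityMeasure ρ ∧ lam = ν ∗ ρ

/-- `G` is the minimal (closed) subgroup containing the support of `lam`. -/
def IsMinimalSubgroup (G : AddSubgroup X) (lam : Measure X) : Prop :=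
  IsLeast {H : AddSubgroup X | IsClosed (H : Set X) ∧ lam.support ⊆ H} G

/-- The Haar distribution `m_F` of a compact subgroup `F` of `X`, as a distribution on `X`. -/
def haarDistribution [IsTopologicalAddGroup X] [BorelSpace X] (F : AddSubgroup X)
    (hF : IsCompact (F : Set X)) : Measure X :=
  haveI : CompactSpace F := isCompact_iff_compactSpace.mp hF
  (Measure.addHaarMeasure (⊤ : TopologicalSpace.PositiveCompacts F)).map Subtype.val

end Distributions

end HeydeQuasicyclic

end

open HeydeQuasicyclic

/-! Let an endomorphism act on characters by composition, and let `f`, `g` be the squared moduli of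
the characteristic functions of `μ₁`, `μ₂`, that is, the characteristic functions of their
symmetrizations. Symmetry of the conditional distribution gives `f((1-α)y) = f((1+α)y) g(2αy)` and
`g((1-α)y) = f(2y) g((1+α)y)`. Multiplication by 2 is invertible on `X`, so `θ = (1-α)²(4α)⁻¹` makes
sense, and since `f, g ≤ 1`, substituting one equation into the other yields `f(θy) ≤ f(y)` and
`g(θy) ≤ g(y)`.

On `X` the powers `θ^(n!)` converge pointwise to a continuous idempotent `Q`, whence `f(Qy) ≤ f(y)`.
At `(1-Q)y` this says `f = 1`, so the symmetrizations live on the fixed points of `Q`. Hence `f` and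
`g` are `θ`-invariant, and the inequalities collapse to `f((1-α)y) = g(2αy)` and `g((1-α)y) =
f(2y)`. Take for `G` the smallest closed subgroup carrying the symmetrization of `μ₁`; that of `μ₂`
gives the same one. Since `Q` is the identity on `G`, `(1-α)G = G`, and a character at which either
characteristic function is nonzero must be trivial on `(1+α)G` (`exists_core`). This makes suitable
shifts of `μ₁` and `μ₂` equal (`exists_common_shift`) and makes the Haar distribution of `(1+α)G` a
factor (`isFactor_haarDistribution`).

The group enters through `IsPowerConvergent`. Endomorphisms of `X` act coordinatewise, each
coordinate being approximated by multiplication by integers; the Chinese remainder theorem then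
makes closed subgroups invariant. Compactness comes from the characters `p^n χ` of `ℤ(p^∞)`: they
tend to 1, so for some `n` the characteristic function is nonzero there, and `p^n` kills the
quasicyclic part of `(1+α)G`. -/

section HeydeAnalysis

open Filter Topology BoundedContinuousFunction

set_option linter.unusedSectionVars false

/-! ### Characteristic functions and the uniqueness theorem -/

section CharFun

theorem continuous_circle_coe : Continuous fun z : Circle => (z : ℂ) := continuous_subtype_val

variable {X : Type*} [AddCommGroup X] [TopologicalSpace X] [MeasurableSpace X]

/-- The characteristic function of a measure at a character. -/
noncomputable def chf (μ : Measure X) (χ : AddChar X Circle) : ℂ := ∫ x, (χ x : ℂ) ∂μ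

theorem norm_chf_le_one (μ : Measure X) [IsProbabilityMeasure μ] (χ : AddChar X Circle) :
    ‖chf μ χ‖ ≤ 1 := by
  refine (norm_integral_le_of_norm_le_const (C := 1)
    (ae_of_all _ fun _ => (Circle.norm_coe _).le)).trans (by simp)

variable [BorelSpace X]

theorem measurable_coe_addChar {χ : AddChar X Circle} (hχ : Continuous χ) :
    Measurable fun x => (χ x : ℂ) :=
  (continuous_circle_coe.comp hχ).measurable

theorem integrable_addChar (μ : Measure X) [IsFiniteMeasure μ] {χ : AddChar X Circle}
    (hχ : Continuous χ) : Integrable (fun x => (χ x : ℂ)) μ :=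
  Integrable.of_bound (measurable_coe_addChar hχ).aestronglyMeasurable 1
    (ae_of_all _ fun _ => (Circle.norm_coe _).le)

theorem chf_map {μ : Measure X} {β : X →+ X} (hβ : Continuous β) {χ : AddChar X Circle}
    (hχ : Continuous χ) : chf (μ.map β) χ = chf μ (χ.compAddMonoidHom β) := by
  unfold chf
  rw [integral_map hβ.measurable.aemeasurable (measurable_coe_addChar hχ).aestronglyMeasurable]
  rfl

theorem chf_eq_one_of_ae {μ : Measure X} [IsProbabilityMeasure μ] {χ : AddChar X Circle}
    (h : ∀ᵐ x ∂μ, χ x = 1) : chf μ χ = 1 := by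
  unfold chf
  rw [integral_congr_ae (g := fun _ => (1 : ℂ))]
  · simp
  · filter_upwards [h] with x hx
    simp [hx]

theorem chf_congr_ae {μ : Measure X} {χ ψ : AddChar X Circle}
    (h : ∀ᵐ x ∂μ, χ x = ψ x) : chf μ χ = chf μ ψ := by
  refine integral_congr_ae ?_
  filter_upwards [h] with x hx
  simp [hx]

theorem circle_eq_one_of_re {z : Circle} (h : (z : ℂ).re = 1) : z = 1 := by
  ext
  have h1 : (z : ℂ).re ^ 2 + (z : ℂ).im ^ 2 = 1 := by
    have := Circle.normSq_coe z
    rw [Complex.normSq_apply] at this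
    linarith
  have h2 : (z : ℂ).im = 0 := by
    rw [h] at h1
    nlinarith
  apply Complex.ext <;> simp [h, h2]

/-- The nonnegative function `1 - Re χ` has integral zero, and 1 is the only point of the circle
with real part 1. -/
theorem ae_eq_one_of_chf_eq_one {μ : Measure X} [IsProbabilityMeasure μ] {χ : AddChar X Circle}
    (hχ : Continuous χ) (h : chf μ χ = 1) : ∀ᵐ x ∂μ, χ x = 1 := by
  have hi := integrable_addChar μ hχ
  have hre : ∫ x, (1 - (χ x : ℂ).re) ∂μ = 0 := by
    have h1 := integral_sub (μ := μ) (integrable_const (1 : ℝ)) hi.re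
    rw [show ∫ x, (1 - (χ x : ℂ).re) ∂μ = _ from h1]
    have h2 : ∫ x, RCLike.re ((χ x : ℂ)) ∂μ = (chf μ χ).re := integral_re hi
    rw [h2, h]
    simp
  have hnn : ∀ x, 0 ≤ 1 - (χ x : ℂ).re := fun x => by
    have := Complex.re_le_norm (χ x : ℂ)
    rw [Circle.norm_coe] at this
    linarith
  rw [integral_eq_zero_iff_of_nonneg hnn ((integrable_const _).sub hi.re)] at hre
  filter_upwards [hre] with x hx
  apply circle_eq_one_of_re
  simp only [Pi.zero_apply] at hx
  linarith

theorem tendsto_chf {μ : Measure X} [IsProbabilityMeasure μ] {χ : ℕ → AddChar X Circle}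
    {ψ : AddChar X Circle} (hχ : ∀ n, Continuous (χ n))
    (h : ∀ x, Tendsto (fun n => χ n x) atTop (𝓝 (ψ x))) :
    Tendsto (fun n => chf μ (χ n)) atTop (𝓝 (chf μ ψ)) := by
  refine tendsto_integral_of_dominated_convergence (fun _ => 1)
    (fun n => (measurable_coe_addChar (hχ n)).aestronglyMeasurable) (integrable_const _)
    (fun n => ae_of_all _ fun x => (Circle.norm_coe _).le) ?_
  refine ae_of_all _ fun x => ?_
  exact (continuous_circle_coe.tendsto _).comp (h x)

/-- A continuous character as a bounded continuous function. -/
noncomputable def charBCF (χ : AddChar X Circle) (hχ : Continuous χ) : X →ᵇ ℂ :=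
  BoundedContinuousFunction.ofNormedAddCommGroup (fun x => (χ x : ℂ))
    (continuous_circle_coe.comp hχ) 1 (fun _ => (Circle.norm_coe _).le)

theorem continuous_inv_addChar {χ : AddChar X Circle} (hχ : Continuous χ) :
    Continuous (χ⁻¹ : AddChar X Circle) := by
  have : (fun x => (χ⁻¹ : AddChar X Circle) x) = fun x => (χ x)⁻¹ := by
    ext x
    simp [AddChar.map_neg_eq_inv]
  change Continuous (fun x => (χ⁻¹ : AddChar X Circle) x)
  rw [this]
  exact hχ.inv

/-- Characters are closed under products and conjugation, so their linear span is a star subalgebra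
of bounded continuous functions. It separates points, and on a Polish space such a subalgebra
determines finite measures. -/
theorem ext_of_chf_eq [PolishSpace X]
    (hsep : ∀ x : X, x ≠ 0 → ∃ χ : AddChar X Circle, Continuous χ ∧ χ x ≠ 1)
    {μ ν : Measure X} [IsProbabilityMeasure μ] [IsProbabilityMeasure ν]
    (h : ∀ χ : AddChar X Circle, Continuous χ → chf μ χ = chf ν χ) : μ = ν := by
  let S : Submonoid (X →ᵇ ℂ) :=
    { carrier := {g | ∃ χ : AddChar X Circle, ∃ hχ : Continuous χ, g = charBCF χ hχ}
      one_mem' := ⟨1, continuous_const, by ext x; simp [charBCF]⟩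
      mul_mem' := by
        rintro _ _ ⟨χ, hχ, rfl⟩ ⟨ψ, hψ, rfl⟩
        exact ⟨χ * ψ, hχ.mul hψ, by ext x; simp [charBCF]⟩ }
  have hstar : star (S : Set (X →ᵇ ℂ)) ⊆ S := by
    rintro g ⟨χ, hχ, hg⟩
    refine ⟨χ⁻¹, continuous_inv_addChar hχ, ?_⟩
    rw [← star_star g, hg]
    ext x
    change (starRingEnd ℂ) (χ x : ℂ) = ((χ⁻¹ : AddChar X Circle) x : ℂ)
    rw [AddChar.inv_apply, AddChar.map_neg_eq_inv, Circle.coe_inv_eq_conj]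
  have hcl : Submonoid.closure ((S : Set (X →ᵇ ℂ)) ∪ star (S : Set (X →ᵇ ℂ))) = S := by
    rw [Set.union_eq_self_of_subset_right hstar, Submonoid.closure_eq]
  refine ext_of_forall_mem_subalgebra_integral_eq_of_polish (𝕜 := ℂ)
    (A := StarAlgebra.adjoin ℂ (S : Set (X →ᵇ ℂ))) ?_ ?_
  · intro x y hxy
    obtain ⟨χ, hχ, hne⟩ := hsep (x - y) (sub_ne_zero.mpr hxy)
    refine ⟨charBCF χ hχ, ⟨_, ⟨charBCF χ hχ, StarAlgebra.subset_adjoin ℂ _ ⟨χ, hχ, rfl⟩, rfl⟩, rfl⟩, ?_⟩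
    intro heq
    apply hne
    have h2 : χ x = χ y := Circle.ext heq
    rw [AddChar.map_sub_eq_div, h2, div_self']
  · intro g hg
    have hg' : g ∈ Submodule.span ℂ (S : Set (X →ᵇ ℂ)) := by
      have := StarAlgebra.adjoin_eq_span (R := ℂ) (S : Set (X →ᵇ ℂ))
      rw [hcl] at this
      rw [← this]
      exact hg
    clear hg
    induction hg' using Submodule.span_induction with
    | mem x hx =>
      obtain ⟨χ, hχ, rfl⟩ := hx
      exact h χ hχ
    | zero => simp
    | add x y _ _ hx hy =>
      simp only [BoundedContinuousFunction.coe_add, Pi.add_apply]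
      rw [integral_add (x.integrable μ) (y.integrable μ), 
        integral_add (x.integrable ν) (y.integrable ν)]
      rw [hx, hy]
    | smul c x _ hx =>
      simp only [BoundedContinuousFunction.coe_smul]
      rw [integral_smul, integral_smul, hx]

end CharFun

/-! ### Continuous endomorphisms acting on characters -/

section ContEnd

variable (X : Type*) [AddCommGroup X] [TopologicalSpace X] [IsTopologicalAddGroup X]

/-- The ring of continuous endomorphisms. -/
def contEnd : Subring (AddMonoid.End X) where
  carrier := {β | Continuous fun x => β x}
  one_mem' := continuous_id
  zero_mem' := continuous_const
  mul_mem' := fun {β γ} (h₁ : Continuous fun x => β x) (h₂ : Continuous fun x => γ x) => h₁.comp h₂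
  add_mem' := fun {_ _} h₁ h₂ => Continuous.add h₁ h₂
  neg_mem' := fun {_} h => Continuous.neg h

/-- The continuous characters. -/
structure ContChar where
  /-- The underlying character. -/
  toAddChar : AddChar X Circle
  continuous : Continuous toAddChar

variable {X}

theorem contEnd_ext {β γ : contEnd X} (h : ∀ x, β.1 x = γ.1 x) : β = γ :=
  Subtype.ext (AddMonoidHom.ext h)

theorem contEnd_continuous (β : contEnd X) : Continuous fun x => β.1 x := β.2

/-- The composition of a character with an endomorphism. -/
noncomputable def ContChar.pull (y : ContChar X) (β : contEnd X) : ContChar X :=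
  ⟨y.1.compAddMonoidHom β.1, y.2.comp β.2⟩

theorem ContChar.pull_apply (y : ContChar X) (β : contEnd X) (x : X) :
    (y.pull β).1 x = y.1 (β.1 x) := rfl

theorem ContChar.pull_pull (y : ContChar X) (β γ : contEnd X) :
    (y.pull β).pull γ = y.pull (β * γ) := rfl

theorem ContChar.pull_one (y : ContChar X) : y.pull 1 = y := rfl

theorem ContChar.pull_add_apply (y : ContChar X) (β γ : contEnd X) (x : X) :
    (y.pull (β + γ)).1 x = (y.pull β).1 x * (y.pull γ).1 x :=
  AddChar.map_add_eq_mul _ _ _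

theorem ContChar.pull_sub_apply (y : ContChar X) (β γ : contEnd X) (x : X) :
    (y.pull (β - γ)).1 x = (y.pull β).1 x / (y.pull γ).1 x :=
  AddChar.map_sub_eq_div _ _ _

theorem ContChar.pull_zero_apply (y : ContChar X) (x : X) : (y.pull 0).1 x = 1 :=
  AddChar.map_zero_eq_one _

theorem contEnd_two_apply (x : X) : (2 : contEnd X).1 x = x + x := by
  rw [← one_add_one_eq_two]
  rfl

/-- The kernel of a character as a subgroup. -/
def ContChar.ker (y : ContChar X) : AddSubgroup X where
  carrier := {x | y.1 x = 1}
  zero_mem' := AddChar.map_zero_eq_one _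
  add_mem' := fun {a b} (ha : y.1 a = 1) (hb : y.1 b = 1) => by
    change y.1 (a + b) = 1
    rw [AddChar.map_add_eq_mul, ha, hb, one_mul]
  neg_mem' := fun {a} (ha : y.1 a = 1) => by
    change y.1 (-a) = 1
    rw [AddChar.map_neg_eq_inv, ha, inv_one]

theorem ContChar.isClosed_ker (y : ContChar X) : IsClosed (y.ker : Set X) :=
  isClosed_eq y.2 continuous_const

end ContEnd

/-! ### Functional inequalities for the squared moduli -/

section Contraction

variable {X : Type*} [AddCommGroup X] [TopologicalSpace X] [IsTopologicalAddGroup X]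
  {a c : contEnd X} {f g : ContChar X → ℝ}

/-- The endomorphism `(I - α)² (4 α)⁻¹`, where `c = (4 α)⁻¹`. -/
def contraction (a c : contEnd X) : contEnd X := c * ((1 - a) * (1 - a))

/-- Put `(1-a)y` into `h₁` and `2ay` into `h₂`: the left side becomes `f(4ay)` times two factors in
`[0, 1]`. -/
theorem apply_pull_sq_le (hf : ∀ y, 0 ≤ f y) (hf1 : ∀ y, f y ≤ 1) (hg : ∀ y, 0 ≤ g y)
    (hg1 : ∀ y, g y ≤ 1)
    (h₁ : ∀ y : ContChar X, f (y.pull (1 - a)) = f (y.pull (1 + a)) * g (y.pull (2 * a)))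
    (h₂ : ∀ y : ContChar X, g (y.pull (1 - a)) = f (y.pull 2) * g (y.pull (1 + a))) (y : ContChar X) :
    f (y.pull ((1 - a) * (1 - a))) ≤ f (y.pull (4 * a)) := by
  have e₁ := h₁ (y.pull (1 - a))
  have e₂ := h₂ (y.pull (2 * a))
  simp only [ContChar.pull_pull] at e₁ e₂
  rw [show (1 - a) * (2 * a) = 2 * a * (1 - a) by noncomm_ring, e₂,
    show 2 * a * 2 = 4 * a by noncomm_ring] at e₁
  rw [e₁]
  refine (mul_le_of_le_one_left (mul_nonneg (hf _) (hg _)) (hf1 _)).trans ?_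
  exact mul_le_of_le_one_right (hf _) (hg1 _)

theorem apply_pull_sq_le' (hf : ∀ y, 0 ≤ f y) (hf1 : ∀ y, f y ≤ 1) (hg : ∀ y, 0 ≤ g y)
    (hg1 : ∀ y, g y ≤ 1)
    (h₁ : ∀ y : ContChar X, f (y.pull (1 - a)) = f (y.pull (1 + a)) * g (y.pull (2 * a)))
    (h₂ : ∀ y : ContChar X, g (y.pull (1 - a)) = f (y.pull 2) * g (y.pull (1 + a))) (y : ContChar X) :
    g (y.pull ((1 - a) * (1 - a))) ≤ g (y.pull (4 * a)) := by
  have e₁ := h₁ (y.pull 2)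
  have e₂ := h₂ (y.pull (1 - a))
  simp only [ContChar.pull_pull] at e₁ e₂
  rw [show (1 - a) * 2 = 2 * (1 - a) by noncomm_ring, e₁,
    show 2 * (2 * a) = 4 * a by noncomm_ring] at e₂
  rw [e₂]
  refine (mul_le_of_le_one_right (mul_nonneg (hf _) (hg _)) (hg1 _)).trans ?_
  exact mul_le_of_le_one_left (hg _) (hf1 _)

theorem apply_pull_contraction_pow_le (hc : c * (4 * a) = 1)
    (h : ∀ y : ContChar X, f (y.pull ((1 - a) * (1 - a))) ≤ f (y.pull (4 * a))) (n : ℕ) (y : ContChar X) :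
    f (y.pull (contraction a c ^ n)) ≤ f y := by
  induction n generalizing y with
  | zero => simp [ContChar.pull_one]
  | succ n ih =>
    rw [pow_succ', ← ContChar.pull_pull]
    refine (ih _).trans ?_
    have := h (y.pull c)
    rwa [ContChar.pull_pull, ContChar.pull_pull, hc, ContChar.pull_one] at this

variable {Q : contEnd X}

/-- Continuity of a function of characters along pointwise convergent sequences. -/
def SeqCont (f : ContChar X → ℝ) : Prop :=
  ∀ (χ : ℕ → ContChar X) (ψ : ContChar X),
    (∀ x, Tendsto (fun n => (χ n).1 x) atTop (𝓝 (ψ.1 x))) →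
    Tendsto (fun n => f (χ n)) atTop (𝓝 (f ψ))

theorem SeqCont.tendsto_pull (hf : SeqCont f) {θ : contEnd X}
    (hQ : ∀ x, Tendsto (fun n : ℕ => (θ ^ n.factorial).1 x) atTop (𝓝 (Q.1 x)))
    (y : ContChar X) :
    Tendsto (fun n : ℕ => f (y.pull (θ ^ n.factorial))) atTop (𝓝 (f (y.pull Q))) :=
  hf _ _ fun x => (y.2.tendsto _).comp (hQ x)

theorem apply_pull_limit_le (hc : c * (4 * a) = 1)
    (h : ∀ y : ContChar X, f (y.pull ((1 - a) * (1 - a))) ≤ f (y.pull (4 * a))) (hf : SeqCont f)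
    (hQ : ∀ x, Tendsto (fun n : ℕ => (contraction a c ^ n.factorial).1 x) atTop (𝓝 (Q.1 x)))
    (y : ContChar X) : f (y.pull Q) ≤ f y :=
  le_of_tendsto (hf.tendsto_pull hQ y)
    (Eventually.of_forall fun _ => apply_pull_contraction_pow_le hc h _ y)

/-- Squeeze: `f(y) = f(Qy)` is the limit of `f(θ^(n!) y)`, and each of these is at most `f(θy) ≤
f(y)` because `n! ≥ 1`. -/
theorem apply_pull_contraction_eq (hc : c * (4 * a) = 1)
    (h : ∀ y : ContChar X, f (y.pull ((1 - a) * (1 - a))) ≤ f (y.pull (4 * a))) (hf : SeqCont f)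
    (hQ : ∀ x, Tendsto (fun n : ℕ => (contraction a c ^ n.factorial).1 x) atTop (𝓝 (Q.1 x)))
    (hfQ : ∀ y : ContChar X, f (y.pull Q) = f y)
    (y : ContChar X) : f (y.pull (contraction a c)) = f y := by
  apply le_antisymm
  · simpa using apply_pull_contraction_pow_le hc h 1 y
  · rw [← hfQ y]
    refine le_of_tendsto (hf.tendsto_pull hQ y) (Eventually.of_forall fun n => ?_)
    obtain ⟨m, hm⟩ := Nat.exists_eq_succ_of_ne_zero n.factorial_ne_zero
    rw [hm, pow_succ', ← ContChar.pull_pull]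
    exact apply_pull_contraction_pow_le hc h m _

/-- `≤` is `h₁` with a factor dropped. For `≥`, invariance rewrites `g(2ay)` as `g(θ·2ay)`, which
`h₂` expresses as `f((1-a)y)` times a factor at most 1. -/
theorem apply_pull_sub_eq (hf : ∀ y, 0 ≤ f y) (hf1 : ∀ y, f y ≤ 1) (hg : ∀ y, 0 ≤ g y)
    (hg1 : ∀ y, g y ≤ 1)
    (h₁ : ∀ y : ContChar X, f (y.pull (1 - a)) = f (y.pull (1 + a)) * g (y.pull (2 * a)))
    (h₂ : ∀ y : ContChar X, g (y.pull (1 - a)) = f (y.pull 2) * g (y.pull (1 + a)))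
    (hc' : 4 * a * c = 1)
    (hgθ : ∀ y : ContChar X, g (y.pull (contraction a c)) = g y) (y : ContChar X) :
    f (y.pull (1 - a)) = g (y.pull (2 * a)) := by
  apply le_antisymm
  · rw [h₁]
    exact mul_le_of_le_one_left (hg _) (hf1 _)
  · rw [← hgθ]
    have e := h₂ (y.pull (2 * a * c * (1 - a)))
    simp only [ContChar.pull_pull] at e ⊢
    rw [show 2 * a * contraction a c = 2 * a * c * (1 - a) * (1 - a) by
      rw [contraction]; noncomm_ring, e,
      show 2 * a * c * (1 - a) * 2 = 4 * a * c * (1 - a) by noncomm_ring, hc', one_mul]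
    exact mul_le_of_le_one_right (hf _) (hg1 _)

theorem commute_of_mul_four_eq_one (hc : c * (4 * a) = 1) (hc' : 4 * a * c = 1) :
    c * a = a * c := by
  calc c * a = c * a * (4 * a * c) := by rw [hc', mul_one]
    _ = c * (4 * a) * a * c := by noncomm_ring
    _ = a * c := by rw [hc, one_mul]

theorem apply_pull_sub_eq' (hf : ∀ y, 0 ≤ f y) (hf1 : ∀ y, f y ≤ 1) (hg : ∀ y, 0 ≤ g y)
    (hg1 : ∀ y, g y ≤ 1)
    (h₁ : ∀ y : ContChar X, f (y.pull (1 - a)) = f (y.pull (1 + a)) * g (y.pull (2 * a)))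
    (h₂ : ∀ y : ContChar X, g (y.pull (1 - a)) = f (y.pull 2) * g (y.pull (1 + a)))
    (hc : c * (4 * a) = 1)
    (hfθ : ∀ y : ContChar X, f (y.pull (contraction a c)) = f y) (y : ContChar X) :
    g (y.pull (1 - a)) = f (y.pull 2) := by
  apply le_antisymm
  · rw [h₂]
    exact mul_le_of_le_one_right (hf _) (hg1 _)
  · rw [← hfθ]
    have e := h₁ (y.pull (2 * c * (1 - a)))
    simp only [ContChar.pull_pull] at e ⊢
    rw [show 2 * contraction a c = 2 * c * (1 - a) * (1 - a) by
      rw [contraction]; noncomm_ring, e,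
      show 2 * c * (1 - a) * (2 * a) = c * (4 * a) * (1 - a) by noncomm_ring, hc, one_mul]
    exact mul_le_of_le_one_left (hg _) (hf1 _)

end Contraction

/-! ### The Heyde functional equation -/

section Measures

variable {X : Type*} [AddCommGroup X] [TopologicalSpace X] [IsTopologicalAddGroup X]
  [PolishSpace X] [MeasurableSpace X] [BorelSpace X]

/-- The Heyde condition in terms of distributions. -/
def HeydeLaw (a : X → X) (μ₁ μ₂ : Measure X) : Prop :=
  (μ₁.prod μ₂).map (fun z => (z.1 + z.2, z.1 + a z.2)) =
    (μ₁.prod μ₂).map (fun z => (z.1 + z.2, -(z.1 + a z.2)))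

/-- The symmetrization of a distribution. -/
noncomputable def symmetrization (μ : Measure X) : Measure X :=
  (μ.prod μ).map fun z => z.1 - z.2

instance (μ : Measure X) [IsProbabilityMeasure μ] : IsProbabilityMeasure (symmetrization μ) :=
  Measure.isProbabilityMeasure_map (by fun_prop)

theorem integral_prod_addChar {μ₁ μ₂ : Measure X} [IsProbabilityMeasure μ₁]
    [IsProbabilityMeasure μ₂] (χ ψ : AddChar X Circle) :
    ∫ z, ((χ z.1 * ψ z.2 : Circle) : ℂ) ∂(μ₁.prod μ₂) = chf μ₁ χ * chf μ₂ ψ := by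
  simp only [Circle.coe_mul]
  exact integral_prod_mul (fun x => (χ x : ℂ)) (fun x => (ψ x : ℂ))

theorem chf_inv (μ : Measure X) (χ : AddChar X Circle) :
    chf μ χ⁻¹ = (starRingEnd ℂ) (chf μ χ) := by
  unfold chf
  rw [← integral_conj]
  congr 1
  ext x
  rw [AddChar.inv_apply, AddChar.map_neg_eq_inv, Circle.coe_inv_eq_conj]

theorem chf_symmetrization (μ : Measure X) [IsProbabilityMeasure μ] (y : ContChar X) :
    chf (symmetrization μ) y.1 = ((‖chf μ y.1‖ ^ 2 : ℝ) : ℂ) := by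
  have h : chf (symmetrization μ) y.1 = chf μ y.1 * chf μ y.1⁻¹ := by
    rw [← integral_prod_addChar]
    unfold chf symmetrization
    rw [integral_map (by fun_prop) (measurable_coe_addChar y.2).aestronglyMeasurable]
    congr 1
    ext z
    rw [AddChar.inv_apply, sub_eq_add_neg, AddChar.map_add_eq_mul]
  rw [h, chf_inv, Complex.mul_conj, Complex.normSq_eq_norm_sq]

/-- Both laws on `X × X` are integrated against the character `(χ, ψ)`; independence splits each
integral into a product. -/
theorem HeydeLaw.chf_eq {a : contEnd X} {μ₁ μ₂ : Measure X} [IsProbabilityMeasure μ₁]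
    [IsProbabilityMeasure μ₂] (H : HeydeLaw a.1 μ₁ μ₂) (χ ψ : ContChar X) :
    chf μ₁ (χ.1 * ψ.1) * chf μ₂ (χ.1 * (ψ.pull a).1) =
      chf μ₁ (χ.1 * ψ.1⁻¹) * chf μ₂ (χ.1 * (ψ.pull a).1⁻¹) := by
  have ha := a.2
  have ham : Measurable fun x => a.1 x := Continuous.measurable ha
  have hm : Measurable fun z : X × X => ((χ.1 z.1 * ψ.1 z.2 : Circle) : ℂ) := by
    simp only [Circle.coe_mul]
    exact ((measurable_coe_addChar χ.2).comp measurable_fst).mul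
      ((measurable_coe_addChar ψ.2).comp measurable_snd)
  have key := congrArg (fun ρ : Measure (X × X) =>
    ∫ z, ((χ.1 z.1 * ψ.1 z.2 : Circle) : ℂ) ∂ρ) H
  rw [integral_map (by fun_prop) hm.aestronglyMeasurable,
    integral_map (by fun_prop) hm.aestronglyMeasurable] at key
  rw [← integral_prod_addChar, ← integral_prod_addChar]
  convert key using 3 with z z
  · congr 1
    simp only [AddChar.mul_apply, AddChar.map_add_eq_mul, ContChar.pull_apply]
    exact mul_mul_mul_comm _ _ _ _
  · congr 1
    simp only [AddChar.mul_apply, AddChar.map_add_eq_mul, ContChar.pull_apply, AddChar.inv_apply,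
      AddChar.map_neg_eq_inv, mul_inv]
    exact mul_mul_mul_comm _ _ _ _

theorem HeydeLaw.chf_two {a : contEnd X} {μ₁ μ₂ : Measure X} [IsProbabilityMeasure μ₁]
    [IsProbabilityMeasure μ₂] (H : HeydeLaw a.1 μ₁ μ₂) (χ : ContChar X) :
    chf μ₂ (χ.pull (1 - a)).1 = chf μ₁ (χ.pull 2).1 * chf μ₂ (χ.pull (1 + a)).1 := by
  have h := H.chf_eq χ χ
  rw [show χ.1 * χ.1⁻¹ = 1 by
    ext x; simp, chf_eq_one_of_ae (χ := 1) (by simp), one_mul] at h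
  convert h.symm using 3
  · ext x
    rw [ContChar.pull_sub_apply, ContChar.pull_one, AddChar.mul_apply, AddChar.inv_apply,
      AddChar.map_neg_eq_inv, div_eq_mul_inv]
  · ext x
    rw [← one_add_one_eq_two, ContChar.pull_add_apply]
    rfl
  · ext x
    rw [ContChar.pull_add_apply]
    rfl

/-- The pair `(χ ∘ a, χ)` is chosen so that the `μ₂` factor on the right is evaluated at the trivial
character; `chf_two` uses `(χ, χ)` to trivialize the `μ₁` factor instead. -/
theorem HeydeLaw.chf_two_mul {a : contEnd X} {μ₁ μ₂ : Measure X} [IsProbabilityMeasure μ₁]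
    [IsProbabilityMeasure μ₂] (H : HeydeLaw a.1 μ₁ μ₂) (χ : ContChar X) :
    (starRingEnd ℂ) (chf μ₁ (χ.pull (1 - a)).1) =
      chf μ₁ (χ.pull (1 + a)).1 * chf μ₂ (χ.pull (2 * a)).1 := by
  have h := H.chf_eq (χ.pull a) χ
  rw [show (χ.pull a).1 * (χ.pull a).1⁻¹ = 1 by
    ext x; simp, chf_eq_one_of_ae (χ := 1) (by simp), mul_one] at h
  rw [← chf_inv]
  convert h.symm using 3
  · ext x
    rw [AddChar.inv_apply, AddChar.map_neg_eq_inv, ContChar.pull_sub_apply, ContChar.pull_one,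
      AddChar.mul_apply, AddChar.inv_apply, AddChar.map_neg_eq_inv, inv_div, div_eq_mul_inv]
  · ext x
    rw [add_comm, ContChar.pull_add_apply]
    rfl
  · ext x
    rw [← one_add_one_eq_two, add_mul, one_mul, ContChar.pull_add_apply]
    rfl

end Measures

/-! ### The subgroup carrying the symmetrizations -/

section Core

/-- The properties of the group which the analysis of the Heyde condition uses: continuous
characters separate the points, closed subgroups are invariant under all continuous endomorphisms,
these map closed subgroups onto closed subgroups, and the powers `θ ^ n!` of a continuous
endomorphism converge pointwise to a continuous idempotent. -/
structure IsPowerConvergent (X : Type*) [AddCommGroup X] [TopologicalSpace X]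
    [IsTopologicalAddGroup X] : Prop where
  separates : ∀ x : X, x ≠ 0 → ∃ χ : AddChar X Circle, Continuous χ ∧ χ x ≠ 1
  invariant : ∀ H : AddSubgroup X, IsClosed (H : Set X) → ∀ β : contEnd X, ∀ x ∈ H, β.1 x ∈ H
  closed_map : ∀ H : AddSubgroup X, IsClosed (H : Set X) → ∀ β : contEnd X,
    IsClosed (H.map β.1 : Set X)
  exists_limit : ∀ θ : contEnd X, ∃ Q : contEnd X, Q * Q = Q ∧
    ∀ x, Tendsto (fun n : ℕ => (θ ^ n.factorial).1 x) atTop (𝓝 (Q.1 x))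

variable {X : Type*} [AddCommGroup X] [TopologicalSpace X] [IsTopologicalAddGroup X]
  [PolishSpace X] [MeasurableSpace X] [BorelSpace X]

theorem ae_symmetrization_iff {μ : Measure X} {S : Set X} (hS : MeasurableSet S) :
    (∀ᵐ x ∂symmetrization μ, x ∈ S) ↔ ∀ᵐ z ∂μ.prod μ, z.1 - z.2 ∈ S :=
  ae_map_iff (by fun_prop) hS

theorem exists_coset_of_ae_symmetrization {μ : Measure X} [IsProbabilityMeasure μ] {S : Set X}
    (hS : MeasurableSet S) (h : ∀ᵐ x ∂symmetrization μ, x ∈ S) (hneg : ∀ x ∈ S, -x ∈ S) :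
    ∃ x₀, ∀ᵐ x ∂μ, x - x₀ ∈ S := by
  obtain ⟨x₀, hx₀⟩ := (Measure.ae_ae_of_ae_prod ((ae_symmetrization_iff hS).1 h)).exists
  refine ⟨x₀, ?_⟩
  filter_upwards [hx₀] with x hx
  simpa using hneg _ hx

theorem ae_symmetrization_of_coset {μ : Measure X} [IsProbabilityMeasure μ] {H : AddSubgroup X}
    (hH : IsClosed (H : Set X)) {x₀ : X} (h : ∀ᵐ x ∂μ, x - x₀ ∈ H) :
    ∀ᵐ x ∂symmetrization μ, x ∈ H := by
  refine (ae_symmetrization_iff (S := (H : Set X)) hH.measurableSet).2 ?_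
  have h1 : ∀ᵐ z ∂μ.prod μ, z.1 - x₀ ∈ H := Measure.quasiMeasurePreserving_fst.ae h
  have h2 : ∀ᵐ z ∂μ.prod μ, z.2 - x₀ ∈ H := Measure.quasiMeasurePreserving_snd.ae h
  filter_upwards [h1, h2] with z hz1 hz2
  simpa using H.sub_mem hz1 hz2

/-- The smallest closed subgroup of full measure. -/
def closedHull (ν : Measure X) : AddSubgroup X :=
  sInf {H : AddSubgroup X | IsClosed (H : Set X) ∧ ν.support ⊆ H}

theorem isClosed_closedHull (ν : Measure X) : IsClosed (closedHull ν : Set X) := by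
  rw [closedHull, AddSubgroup.coe_sInf]
  exact isClosed_biInter fun H hH => hH.1

theorem ae_mem_closedHull (ν : Measure X) : ∀ᵐ x ∂ν, x ∈ closedHull ν := by
  filter_upwards [Measure.support_mem_ae (μ := ν)] with x hx
  rw [closedHull, AddSubgroup.mem_sInf]
  exact fun H hH => hH.2 hx

theorem closedHull_le {ν : Measure X} {H : AddSubgroup X} (hH : IsClosed (H : Set X))
    (h : ∀ᵐ x ∂ν, x ∈ H) : closedHull ν ≤ H :=
  sInf_le ⟨hH, Measure.support_subset_of_isClosed hH h⟩

theorem isProbabilityMeasure_map_contEnd (β : contEnd X) (ν : Measure X) [IsProbabilityMeasure ν] :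
    IsProbabilityMeasure (ν.map β.1) :=
  Measure.isProbabilityMeasure_map (contEnd_continuous β).measurable.aemeasurable

theorem ae_map_contEnd_iff {β : contEnd X} {ν : Measure X} {S : Set X} (hS : MeasurableSet S) :
    (∀ᵐ x ∂ν.map β.1, x ∈ S) ↔ ∀ᵐ x ∂ν, β.1 x ∈ S :=
  ae_map_iff (contEnd_continuous β).measurable.aemeasurable hS

theorem chf_map_contEnd (β : contEnd X) (ν : Measure X) (y : ContChar X) :
    chf (ν.map β.1) y.1 = chf ν (y.pull β).1 :=
  chf_map (contEnd_continuous β) y.2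

theorem map_eq_map_of_chf (hX : IsPowerConvergent X) {ν₁ ν₂ : Measure X} [IsProbabilityMeasure ν₁]
    [IsProbabilityMeasure ν₂] {β γ : contEnd X}
    (h : ∀ y : ContChar X, chf ν₁ (y.pull β).1 = chf ν₂ (y.pull γ).1) :
    ν₁.map β.1 = ν₂.map γ.1 := by
  have := isProbabilityMeasure_map_contEnd β ν₁
  have := isProbabilityMeasure_map_contEnd γ ν₂
  refine ext_of_chf_eq hX.separates fun χ hχ => ?_
  exact (chf_map_contEnd β ν₁ ⟨χ, hχ⟩).trans
    ((h ⟨χ, hχ⟩).trans (chf_map_contEnd γ ν₂ ⟨χ, hχ⟩).symm)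

/-- `β` preserves `H`, so the common image measure is carried by `H`; applying `δ`, which also
preserves `H`, undoes `γ`. -/
theorem ae_mem_of_map_eq (hX : IsPowerConvergent X) {ν₁ ν₂ : Measure X} {β γ δ : contEnd X}
    (h : ν₁.map β.1 = ν₂.map γ.1) (hδ : δ * γ = 1) {H : AddSubgroup X}
    (hH : IsClosed (H : Set X)) (h₁ : ∀ᵐ x ∂ν₁, x ∈ H) : ∀ᵐ x ∂ν₂, x ∈ H := by
  have hm : MeasurableSet {x | x ∈ H} := hH.measurableSet
  have h2 : ∀ᵐ x ∂ν₁.map β.1, x ∈ H := by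
    rw [ae_map_iff (contEnd_continuous β).measurable.aemeasurable hm]
    filter_upwards [h₁] with x hx using hX.invariant H hH β x hx
  rw [h, ae_map_iff (contEnd_continuous γ).measurable.aemeasurable hm] at h2
  filter_upwards [h2] with x hx
  have h3 := hX.invariant H hH δ _ hx
  have h4 : (δ * γ).1 x ∈ H := h3
  rwa [hδ] at h4

theorem seqCont_norm_sq_chf (μ : Measure X) [IsProbabilityMeasure μ] :
    SeqCont fun y : ContChar X => ‖chf μ y.1‖ ^ 2 := fun χ _ h =>
  ((tendsto_chf (fun n => (χ n).2) h).norm.pow 2)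

theorem ae_symmetrization_eq_one {μ : Measure X} [IsProbabilityMeasure μ] {y : ContChar X}
    (h : ‖chf μ y.1‖ ^ 2 = 1) : ∀ᵐ x ∂symmetrization μ, y.1 x = 1 := by
  apply ae_eq_one_of_chf_eq_one y.2
  rw [chf_symmetrization, h, Complex.ofReal_one]

/-- Since `(1-Q)Q = 0`, the hypothesis at `(1-Q)y` bounds the squared modulus below by 1. So `1-Q`
maps the symmetrization to the point mass at 0. -/
theorem ae_symmetrization_fixed (hX : IsPowerConvergent X) {μ : Measure X}
    [IsProbabilityMeasure μ] {Q : contEnd X} (hQ : Q * Q = Q)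
    (h : ∀ y : ContChar X, ‖chf μ (y.pull Q).1‖ ^ 2 ≤ ‖chf μ y.1‖ ^ 2) :
    ∀ᵐ x ∂symmetrization μ, Q.1 x = x := by
  have h0 : ∀ y : ContChar X, chf μ (y.pull 0).1 = 1 := fun y =>
    chf_eq_one_of_ae (ae_of_all _ y.pull_zero_apply)
  have h1 : ∀ y : ContChar X, ‖chf μ (y.pull (1 - Q)).1‖ ^ 2 = 1 := fun y => by
    apply le_antisymm
    · exact pow_le_one₀ (norm_nonneg _) (norm_chf_le_one _ _)
    · have := h (y.pull (1 - Q))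
      rw [ContChar.pull_pull, sub_mul, hQ, one_mul, sub_self, h0] at this
      simpa using this
  have hmap : (symmetrization μ).map (1 - Q).1 = (symmetrization μ).map (0 : contEnd X).1 := by
    refine map_eq_map_of_chf hX fun y => ?_
    rw [chf_symmetrization, chf_symmetrization, h1, h0]
    simp
  have hm : MeasurableSet ({0} : Set X) := isClosed_singleton.measurableSet
  have h2 : ∀ᵐ x ∂(symmetrization μ).map (0 : contEnd X).1, x ∈ ({0} : Set X) := by
    rw [ae_map_contEnd_iff hm]
    exact ae_of_all _ fun x => rfl
  rw [← hmap, ae_map_contEnd_iff hm] at h2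
  filter_upwards [h2] with x hx
  have : x - Q.1 x = 0 := hx
  exact (sub_eq_zero.1 this).symm

theorem norm_chf_eq_of_ae_symmetrization {μ : Measure X} [IsProbabilityMeasure μ]
    {y z : ContChar X} (h : ∀ᵐ x ∂symmetrization μ, y.1 x = z.1 x) :
    ‖chf μ y.1‖ ^ 2 = ‖chf μ z.1‖ ^ 2 := by
  have := chf_congr_ae h
  rw [chf_symmetrization, chf_symmetrization] at this
  exact_mod_cast this

/-- This extracts from the Heyde condition what no shift can change: the group `G`, equal to the
closed hull of either symmetrization, and the vanishing of both characteristic functions off the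
annihilator of `(1+a)G`. -/
theorem exists_core (hX : IsPowerConvergent X) {a c : contEnd X} (hc : c * (4 * a) = 1)
    (hc' : 4 * a * c = 1) {μ₁ μ₂ : Measure X} [IsProbabilityMeasure μ₁] [IsProbabilityMeasure μ₂]
    (H : HeydeLaw a.1 μ₁ μ₂) :
    ∃ G : AddSubgroup X, IsClosed (G : Set X) ∧ (∃ x₁, ∀ᵐ x ∂μ₁, x - x₁ ∈ G) ∧
      (∃ x₂, ∀ᵐ x ∂μ₂, x - x₂ ∈ G) ∧
      (∀ K : AddSubgroup X, IsClosed (K : Set X) → ∀ x₀, (∀ᵐ x ∂μ₁, x - x₀ ∈ K) → G ≤ K) ∧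
      G.map (1 - a).1 = G ∧
      (∀ y : ContChar X, chf μ₁ y.1 ≠ 0 → ∀ x ∈ G, y.1 ((1 + a).1 x) = 1) ∧
      (∀ y : ContChar X, chf μ₂ y.1 ≠ 0 → ∀ x ∈ G, y.1 ((1 + a).1 x) = 1) := by
  set f : ContChar X → ℝ := fun y => ‖chf μ₁ y.1‖ ^ 2 with hf
  set g : ContChar X → ℝ := fun y => ‖chf μ₂ y.1‖ ^ 2 with hg
  have f0 : ∀ y, 0 ≤ f y := fun y => by positivity
  have g0 : ∀ y, 0 ≤ g y := fun y => by positivity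
  have f1 : ∀ y, f y ≤ 1 := fun y => pow_le_one₀ (norm_nonneg _) (norm_chf_le_one _ _)
  have g1 : ∀ y, g y ≤ 1 := fun y => pow_le_one₀ (norm_nonneg _) (norm_chf_le_one _ _)
  have h₁ : ∀ y : ContChar X, f (y.pull (1 - a)) = f (y.pull (1 + a)) * g (y.pull (2 * a)) :=
    fun y => by
      have := congrArg (fun z : ℂ => ‖z‖ ^ 2) (H.chf_two_mul y)
      simpa only [norm_mul, mul_pow, RCLike.norm_conj] using this
  have h₂ : ∀ y : ContChar X, g (y.pull (1 - a)) = f (y.pull 2) * g (y.pull (1 + a)) :=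
    fun y => by
      have := congrArg (fun z : ℂ => ‖z‖ ^ 2) (H.chf_two y)
      simpa only [norm_mul, mul_pow] using this
  obtain ⟨Q, hQQ, hQ⟩ := hX.exists_limit (contraction a c)
  have hle := apply_pull_sq_le f0 f1 g0 g1 h₁ h₂
  have hle' := apply_pull_sq_le' f0 f1 g0 g1 h₁ h₂
  have hfs : SeqCont f := seqCont_norm_sq_chf μ₁
  have hgs : SeqCont g := seqCont_norm_sq_chf μ₂
  have hfix₁ := ae_symmetrization_fixed hX hQQ (apply_pull_limit_le hc hle hfs hQ)
  have hfix₂ := ae_symmetrization_fixed hX hQQ (apply_pull_limit_le hc hle' hgs hQ)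
  have hfθ := apply_pull_contraction_eq hc hle hfs hQ fun y =>
    norm_chf_eq_of_ae_symmetrization (y := y.pull Q) (z := y) (by
      filter_upwards [hfix₁] with x hx
      rw [ContChar.pull_apply, hx])
  have hgθ := apply_pull_contraction_eq hc hle' hgs hQ fun y =>
    norm_chf_eq_of_ae_symmetrization (y := y.pull Q) (z := y) (by
      filter_upwards [hfix₂] with x hx
      rw [ContChar.pull_apply, hx])
  have hfg := apply_pull_sub_eq f0 f1 g0 g1 h₁ h₂ hc' hgθ
  have hgf := apply_pull_sub_eq' f0 f1 g0 g1 h₁ h₂ hc hfθ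
  have hmap₁ : (symmetrization μ₁).map (1 - a).1 = (symmetrization μ₂).map (2 * a).1 :=
    map_eq_map_of_chf hX fun y => by
      rw [chf_symmetrization, chf_symmetrization]
      exact congrArg Complex.ofReal (hfg y)
  have hmap₂ : (symmetrization μ₂).map (1 - a).1 = (symmetrization μ₁).map (2 : contEnd X).1 :=
    map_eq_map_of_chf hX fun y => by
      rw [chf_symmetrization, chf_symmetrization]
      exact congrArg Complex.ofReal (hgf y)
  set G := closedHull (symmetrization μ₁) with hG
  have hGc : IsClosed (G : Set X) := isClosed_closedHull _
  have hG₁ : ∀ᵐ x ∂symmetrization μ₁, x ∈ G := ae_mem_closedHull _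
  have hG₂ : ∀ᵐ x ∂symmetrization μ₂, x ∈ G :=
    ae_mem_of_map_eq hX hmap₁ (δ := c * 2) (by rw [← hc]; noncomm_ring) hGc hG₁
  have hGle₁ : ∀ K : AddSubgroup X, IsClosed (K : Set X) →
      (∀ᵐ x ∂symmetrization μ₁, x ∈ K) → G ≤ K := fun K hK h => closedHull_le hK h
  have hGle₂ : ∀ K : AddSubgroup X, IsClosed (K : Set X) →
      (∀ᵐ x ∂symmetrization μ₂, x ∈ K) → G ≤ K := fun K hK h =>
    closedHull_le hK (ae_mem_of_map_eq hX hmap₂ (δ := c * (2 * a)) (by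
      rw [← hc]; noncomm_ring) hK h)
  have hGQ : ∀ x ∈ G, Q.1 x = x := by
    have : G ≤ (Q.1 - 1 : AddMonoid.End X).ker := by
      refine hGle₁ _ ?_ ?_
      · exact isClosed_eq ((contEnd_continuous Q).sub continuous_id) continuous_const
      · filter_upwards [hfix₁] with x hx
        change Q.1 x - x = 0
        rw [hx, sub_self]
    exact fun x hx => sub_eq_zero.1 (this hx)
  have hcomm : c * a = a * c := commute_of_mul_four_eq_one hc hc'
  have hGmap : G.map (1 - a).1 = G := by
    apply le_antisymm
    · rintro _ ⟨x, hx, rfl⟩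
      exact hX.invariant G hGc (1 - a) x hx
    -- On `G` the limit `Q` is the identity, so `x` is a limit of points `θ^(n!) x`; as `n! ≥ 1`, a
    -- factor `1-a` can be pulled out, and these points lie in the closed group `(1-a)G`.
    · intro x hx
      have hlim := hQ x
      rw [hGQ x hx] at hlim
      refine (hX.closed_map G hGc (1 - a)).mem_of_tendsto hlim (Eventually.of_forall fun n => ?_)
      obtain ⟨m, hm⟩ := Nat.exists_eq_succ_of_ne_zero n.factorial_ne_zero
      have : contraction a c ^ n.factorial =
          (1 - a) * (c * (1 - a) * contraction a c ^ m) := by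
        rw [hm, pow_succ', contraction]
        have h3 : c * (1 - a) = (1 - a) * c := by
          rw [mul_sub, sub_mul, hcomm, mul_one, one_mul]
        rw [← mul_assoc c, ← mul_assoc (1 - a), ← mul_assoc (1 - a), ← h3]
      rw [this]
      exact ⟨_, hX.invariant G hGc _ x hx, rfl⟩
  -- Nothing is lost by the extra factor `c(1-a)`: `c` is undone by `4a`, which preserves `G`, and
  -- `(1-a)G = G`.
  have hspread : ∀ y : ContChar X, (∀ x ∈ G, y.1 ((c * (1 - a) * (1 + a)).1 x) = 1) →
      ∀ x ∈ G, y.1 ((1 + a).1 x) = 1 := by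
    intro y hy x hx
    rw [← hGmap] at hx
    obtain ⟨x', hx', rfl⟩ := hx
    have h4 := hy _ (hX.invariant G hGc (4 * a) x' hx')
    have h5 : c * (1 - a) * (1 + a) * (4 * a) = (1 + a) * (1 - a) := by
      calc c * (1 - a) * (1 + a) * (4 * a) = c * (4 * a) * ((1 + a) * (1 - a)) := by noncomm_ring
        _ = _ := by rw [hc, one_mul]
    have h6 : y.1 ((c * (1 - a) * (1 + a) * (4 * a)).1 x') = 1 := h4
    rw [h5] at h6
    exact h6
  refine ⟨G, hGc, ?_, ?_, ?_, hGmap, ?_, ?_⟩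
  · exact exists_coset_of_ae_symmetrization hGc.measurableSet hG₁ fun x hx => G.neg_mem hx
  · exact exists_coset_of_ae_symmetrization hGc.measurableSet hG₂ fun x hx => G.neg_mem hx
  · exact fun K hK x₀ h => hGle₁ K hK (ae_symmetrization_of_coset hK h)
  · intro y hy
    apply hspread
    have hne : f y ≠ 0 := by simpa [hf] using hy
    rw [← hfθ y, show contraction a c = c * (1 - a) * (1 - a) by
      rw [contraction, mul_assoc], ← ContChar.pull_pull] at hne
    -- With `z = c(1-a)y` this reads `f((1-a)z) = f((1+a)z) f((1-a)z)`. The common factor equals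
    -- `f(y) ≠ 0`, so `f((1+a)z) = 1`.
    have e := h₁ (y.pull (c * (1 - a)))
    rw [← hfg] at e
    have h7 : f ((y.pull (c * (1 - a))).pull (1 + a)) = 1 := mul_right_cancel₀ hne (by
      rw [one_mul]; exact e.symm)
    exact fun x hx => hGle₁ _ (ContChar.isClosed_ker _) (ae_symmetrization_eq_one h7) hx
  · intro y hy
    apply hspread
    have hne : g y ≠ 0 := by simpa [hg] using hy
    rw [← hgθ y, show contraction a c = c * (1 - a) * (1 - a) by
      rw [contraction, mul_assoc], ← ContChar.pull_pull] at hne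
    have e := h₂ (y.pull (c * (1 - a)))
    rw [← hgf] at e
    have h7 : g ((y.pull (c * (1 - a))).pull (1 + a)) = 1 := mul_left_cancel₀ hne (by
      rw [mul_one]; exact e.symm)
    exact fun x hx => hGle₂ _ (ContChar.isClosed_ker _) (ae_symmetrization_eq_one h7) hx

end Core

/-! ### A common shift, Haar factors, and random variables -/

section Shift

variable {X : Type*} [AddCommGroup X] [TopologicalSpace X] [IsTopologicalAddGroup X]
  [PolishSpace X] [MeasurableSpace X] [BorelSpace X]

theorem chf_map_add_right (μ : Measure X) (t : X) (y : ContChar X) :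
    chf (μ.map (· + t)) y.1 = chf μ y.1 * (y.1 t : ℂ) := by
  unfold chf
  rw [integral_map (by fun_prop) (measurable_coe_addChar y.2).aestronglyMeasurable,
    ← integral_mul_const]
  congr 1
  ext x
  rw [AddChar.map_add_eq_mul, Circle.coe_mul]

theorem isShift_of_map_add (μ : Measure X) [IsProbabilityMeasure μ] (t : X) :
    IsShift μ (μ.map (· + t)) := by
  refine ⟨-t, ?_⟩
  have : IsProbabilityMeasure (μ.map (· + t)) := Measure.isProbabilityMeasure_map (by fun_prop)
  rw [Measure.conv_dirac, Measure.map_map (by fun_prop) (by fun_prop)]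
  simp [Function.comp_def]

/-- The two shifts cancel in `ξ₁ + aξ₂`, while `ξ₁ + ξ₂` moves by a constant, which does not affect
the symmetry. -/
theorem HeydeLaw.shift {a : contEnd X} {μ₁ μ₂ : Measure X} [IsProbabilityMeasure μ₁]
    [IsProbabilityMeasure μ₂] (H : HeydeLaw a.1 μ₁ μ₂) (t : X) :
    HeydeLaw a.1 (μ₁.map (· + a.1 t)) (μ₂.map (· + -t)) := by
  have ha := (contEnd_continuous a).measurable
  have key := congrArg (Measure.map fun w : X × X => (w.1 + (a.1 t + -t), w.2)) H
  rw [Measure.map_map (by fun_prop) (by fun_prop),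
    Measure.map_map (by fun_prop) (by fun_prop)] at key
  unfold HeydeLaw
  rw [Measure.map_prod_map _ _ (by fun_prop) (by fun_prop),
    Measure.map_map (by fun_prop) (by fun_prop), Measure.map_map (by fun_prop) (by fun_prop)]
  convert key using 2
  · ext z <;> simp <;> abel
  · ext z <;> simp <;> abel

/-- Shift `μ₂` into `G` and `μ₁` correspondingly. Outside the annihilator of `(1+a)G` both
characteristic functions vanish; on it, `1-a` and `2` act alike on characters of `G`, and the second
functional equation identifies the two. -/
theorem exists_common_shift (hX : IsPowerConvergent X) {a c : contEnd X} (hc : c * (4 * a) = 1)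
    (hc' : 4 * a * c = 1) {μ₁ μ₂ : Measure X} [IsProbabilityMeasure μ₁] [IsProbabilityMeasure μ₂]
    (H : HeydeLaw a.1 μ₁ μ₂) :
    ∃ (G : AddSubgroup X) (lam : Measure X), IsClosed (G : Set X) ∧ IsProbabilityMeasure lam ∧
      (∀ᵐ x ∂lam, x ∈ G) ∧ IsShift μ₁ lam ∧ IsShift μ₂ lam ∧ IsMinimalSubgroup G lam ∧
      G.map (1 - a).1 = G ∧ HeydeLaw a.1 lam lam ∧
      (∀ y : ContChar X, chf lam y.1 ≠ 0 → ∀ x ∈ G, y.1 ((1 + a).1 x) = 1) := by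
  obtain ⟨G, hGc, ⟨x₁, hx₁⟩, ⟨x₂, hx₂⟩, hGle, hGmap, htriv₁, htriv₂⟩ := exists_core hX hc hc' H
  have ha := (contEnd_continuous a).measurable
  have hGm : MeasurableSet (G : Set X) := hGc.measurableSet
  have hmem : x₁ + a.1 x₂ ∈ G := by
    have e1 : ∀ᵐ z ∂μ₁.prod μ₂, z.1 - x₁ ∈ G := Measure.quasiMeasurePreserving_fst.ae hx₁
    have e2 : ∀ᵐ z ∂μ₁.prod μ₂, z.2 - x₂ ∈ G := Measure.quasiMeasurePreserving_snd.ae hx₂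
    have hS : MeasurableSet {w : X × X | w.2 - (x₁ + a.1 x₂) ∈ G} :=
      hGm.preimage (f := fun w : X × X => w.2 - (x₁ + a.1 x₂)) (by fun_prop)
    have e3 : ∀ᵐ z ∂μ₁.prod μ₂, (z.1 + a.1 z.2) - (x₁ + a.1 x₂) ∈ G := by
      filter_upwards [e1, e2] with z h1 h2
      have h3 := G.add_mem h1 (hX.invariant G hGc a _ h2)
      rw [map_sub] at h3
      convert h3 using 1
      abel
    have e4 : ∀ᵐ w ∂(μ₁.prod μ₂).map (fun z => (z.1 + z.2, z.1 + a.1 z.2)),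
        w ∈ {w : X × X | w.2 - (x₁ + a.1 x₂) ∈ G} := by
      refine (ae_map_iff (by fun_prop) hS).2 e3
    rw [H] at e4
    have e5 : ∀ᵐ z ∂μ₁.prod μ₂, -(z.1 + a.1 z.2) - (x₁ + a.1 x₂) ∈ G :=
      (ae_map_iff (by fun_prop) hS).1 e4
    obtain ⟨z, h3, h5⟩ := (e3.and e5).exists
    -- The law of `ξ₁ + aξ₂` lives on the coset of `x₁ + ax₂` and is symmetric, so this coset equals
    -- its own negative.
    have h6 : (2 : contEnd X).1 (x₁ + a.1 x₂) ∈ G := by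
      rw [contEnd_two_apply]
      convert G.neg_mem (G.add_mem h3 h5) using 1
      abel
    have h7 := hX.invariant G hGc (c * (2 * a)) _ h6
    have h8 : (c * (2 * a) * 2).1 (x₁ + a.1 x₂) ∈ G := h7
    rwa [show c * (2 * a) * 2 = c * (4 * a) by noncomm_ring, hc] at h8
  set l₁ := μ₁.map (· + a.1 x₂) with hl₁
  set l₂ := μ₂.map (· + -x₂) with hl₂
  have : IsProbabilityMeasure l₁ := Measure.isProbabilityMeasure_map (by fun_prop)
  have : IsProbabilityMeasure l₂ := Measure.isProbabilityMeasure_map (by fun_prop)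
  have H' : HeydeLaw a.1 l₁ l₂ := H.shift x₂
  have hl₂G : ∀ᵐ x ∂l₂, x ∈ G := by
    refine (ae_map_iff (p := fun x => x ∈ G) (by fun_prop) hGm).2 ?_
    filter_upwards [hx₂] with x hx
    rwa [← sub_eq_add_neg]
  have t₁ : ∀ y : ContChar X, chf l₁ y.1 ≠ 0 → ∀ x ∈ G, y.1 ((1 + a).1 x) = 1 := by
    intro y hy
    rw [hl₁, chf_map_add_right] at hy
    exact htriv₁ y (left_ne_zero_of_mul hy)
  have t₂ : ∀ y : ContChar X, chf l₂ y.1 ≠ 0 → ∀ x ∈ G, y.1 ((1 + a).1 x) = 1 := by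
    intro y hy
    rw [hl₂, chf_map_add_right] at hy
    exact htriv₂ y (left_ne_zero_of_mul hy)
  have hhalf : ∀ y : ContChar X, (∀ x ∈ G, (y.pull 2).1 ((1 + a).1 x) = 1) →
      chf l₁ (y.pull 2).1 = chf l₂ (y.pull 2).1 := by
    intro y hy
    have h1 : ∀ x ∈ G, (y.pull (1 + a)).1 x = 1 := by
      intro x hx
      have h2 : y.1 ((2 * (1 + a) * (c * (2 * a))).1 x) = 1 :=
        hy _ (hX.invariant G hGc (c * (2 * a)) x hx)
      rwa [show 2 * (1 + a) * (c * (2 * a)) = (1 + a) * (c * (4 * a)) by noncomm_ring, hc,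
        mul_one] at h2
    have h3 : chf l₂ (y.pull (1 + a)).1 = 1 := chf_eq_one_of_ae (by
      filter_upwards [hl₂G] with x hx using h1 x hx)
    have h4 := H'.chf_two y
    rw [h3, mul_one] at h4
    rw [← h4]
    refine chf_congr_ae ?_
    filter_upwards [hl₂G] with x hx
    rw [show (1 - a) = 2 - (1 + a) by rw [← one_add_one_eq_two]; abel,
      ContChar.pull_sub_apply, h1 x hx, div_one]
  have heq : l₁ = l₂ := by
    refine ext_of_chf_eq hX.separates fun χ hχ => ?_
    -- Every character is twice another one, because 2 is invertible; so `hhalf` reaches all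
    -- characters.
    have hy : ((⟨χ, hχ⟩ : ContChar X).pull (c * (2 * a))).pull 2 = ⟨χ, hχ⟩ := by
      rw [ContChar.pull_pull, show c * (2 * a) * 2 = c * (4 * a) by noncomm_ring, hc,
        ContChar.pull_one]
    by_cases h : chf l₁ χ = 0 ∧ chf l₂ χ = 0
    · rw [h.1, h.2]
    · have h' := hhalf ((⟨χ, hχ⟩ : ContChar X).pull (c * (2 * a)))
      rw [hy] at h'
      rcases not_and_or.1 h with h | h
      · exact h' (t₁ ⟨χ, hχ⟩ h)
      · exact h' (t₂ ⟨χ, hχ⟩ h)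
  refine ⟨G, l₂, hGc, inferInstance, hl₂G, heq ▸ isShift_of_map_add _ _, isShift_of_map_add _ _,
    ⟨⟨hGc, Measure.support_subset_of_isClosed hGc hl₂G⟩, ?_⟩, hGmap, ?_, t₂⟩
  · rintro K ⟨hK, hsupp⟩
    refine hGle K hK (-a.1 x₂) ?_
    have h1 : ∀ᵐ x ∂l₁, x ∈ K := by
      rw [heq]
      filter_upwards [Measure.support_mem_ae (μ := l₂)] with x hx using hsupp hx
    have h2 := (ae_map_iff (p := fun x => x ∈ K) (by fun_prop) hK.measurableSet).1 h1
    filter_upwards [h2] with x hx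
    rwa [sub_neg_eq_add]
  · rw [heq] at H'
    exact H'

theorem isProbabilityMeasure_haarDistribution (F : AddSubgroup X) (hF : IsCompact (F : Set X)) :
    IsProbabilityMeasure (haarDistribution F hF) := by
  have : CompactSpace F := isCompact_iff_compactSpace.mp hF
  have h : IsProbabilityMeasure
      (Measure.addHaarMeasure (⊤ : TopologicalSpace.PositiveCompacts F)) :=
    ⟨by simpa using Measure.addHaarMeasure_self (K₀ := (⊤ : TopologicalSpace.PositiveCompacts F))⟩
  exact Measure.isProbabilityMeasure_map measurable_subtype_coe.aemeasurable

theorem ae_mem_haarDistribution (F : AddSubgroup X) (hF : IsCompact (F : Set X)) :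
    ∀ᵐ x ∂haarDistribution F hF, x ∈ F := by
  refine (ae_map_iff (p := fun x => x ∈ F) measurable_subtype_coe.aemeasurable
    hF.isClosed.measurableSet).2 ?_
  exact ae_of_all _ fun x => x.2

theorem chf_conv (μ ν : Measure X) [IsProbabilityMeasure μ] [IsProbabilityMeasure ν]
    (y : ContChar X) : chf (μ ∗ ν) y.1 = chf μ y.1 * chf ν y.1 := by
  rw [← integral_prod_addChar]
  unfold chf Measure.conv
  rw [integral_map (by fun_prop) (measurable_coe_addChar y.2).aestronglyMeasurable]
  congr 1
  ext z
  rw [AddChar.map_add_eq_mul]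

/-- The cofactor is `lam` itself: `m_F ∗ lam = lam`, since `m_F` has characteristic function 1
wherever that of `lam` is nonzero. -/
theorem isFactor_haarDistribution (hX : IsPowerConvergent X) {lam : Measure X}
    [IsProbabilityMeasure lam] (F : AddSubgroup X) (hF : IsCompact (F : Set X))
    (h : ∀ y : ContChar X, chf lam y.1 ≠ 0 → ∀ x ∈ F, y.1 x = 1) :
    IsFactor (haarDistribution F hF) lam := by
  have := isProbabilityMeasure_haarDistribution F hF
  refine ⟨lam, inferInstance, ext_of_chf_eq hX.separates fun χ hχ => ?_⟩
  have e := chf_conv (haarDistribution F hF) lam ⟨χ, hχ⟩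
  refine Eq.trans ?_ e.symm
  by_cases h0 : chf lam χ = 0
  · simp [h0]
  · rw [chf_eq_one_of_ae (μ := haarDistribution F hF), one_mul]
    filter_upwards [ae_mem_haarDistribution F hF] with x hx using h ⟨χ, hχ⟩ h0 x hx

theorem HeydeLaw.of_condSymmetric {Ω : Type*} [MeasurableSpace Ω] {Pr : Measure Ω}
    [IsProbabilityMeasure Pr] {a : contEnd X} {ξ₁ ξ₂ : Ω → X} (h₁ : Measurable ξ₁)
    (h₂ : Measurable ξ₂) (hind : IndepFun ξ₁ ξ₂ Pr)
    (h : CondSymmetric (fun ω => ξ₁ ω + ξ₂ ω) (fun ω => ξ₁ ω + a.1 (ξ₂ ω)) Pr) :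
    HeydeLaw a.1 (Pr.map ξ₁) (Pr.map ξ₂) := by
  have ha := (contEnd_continuous a).measurable
  unfold HeydeLaw
  rw [← (indepFun_iff_map_prod_eq_prod_map_map h₁.aemeasurable h₂.aemeasurable).1 hind,
    Measure.map_map (by fun_prop) (by fun_prop), Measure.map_map (by fun_prop) (by fun_prop)]
  exact h.map_eq

theorem HeydeLaw.condSymmetric {Ω : Type*} [MeasurableSpace Ω] {Pr : Measure Ω}
    [IsProbabilityMeasure Pr] {a : contEnd X} {ξ₁ ξ₂ : Ω → X} (h₁ : Measurable ξ₁)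
    (h₂ : Measurable ξ₂) (hind : IndepFun ξ₁ ξ₂ Pr)
    (h : HeydeLaw a.1 (Pr.map ξ₁) (Pr.map ξ₂)) :
    CondSymmetric (fun ω => ξ₁ ω + ξ₂ ω) (fun ω => ξ₁ ω + a.1 (ξ₂ ω)) Pr := by
  have ha := (contEnd_continuous a).measurable
  unfold HeydeLaw at h
  rw [← (indepFun_iff_map_prod_eq_prod_map_map h₁.aemeasurable h₂.aemeasurable).1 hind,
    Measure.map_map (by fun_prop) (by fun_prop), Measure.map_map (by fun_prop) (by fun_prop)] at h
  exact ⟨by fun_prop, by fun_prop, h⟩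

/-- The inclusion of `G × G` is a measurable embedding, so a law on it is recovered from its image.
-/
theorem HeydeQuasicyclic.CondSymmetric.of_coe {Ω : Type*} [MeasurableSpace Ω] {Pr : Measure Ω} {G : AddSubgroup X}
    (hG : MeasurableSet (G : Set X)) {ξ η : Ω → G} (hξ : Measurable ξ) (hη : Measurable η)
    (h : CondSymmetric (fun ω => (ξ ω : X)) (fun ω => (η ω : X)) Pr) : CondSymmetric ξ η Pr := by
  have hemb : MeasurableEmbedding (Prod.map ((↑) : G → X) ((↑) : G → X)) :=
    (MeasurableEmbedding.subtype_coe hG).prodMap (MeasurableEmbedding.subtype_coe hG)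
  have hη' : Measurable fun ω => -η ω := hη.neg
  have key := h.map_eq
  refine ⟨(hξ.prodMk hη).aemeasurable, (hξ.prodMk hη').aemeasurable, ?_⟩
  rw [← hemb.comap_map (Measure.map (fun ω => (ξ ω, η ω)) Pr),
    ← hemb.comap_map (Measure.map (fun ω => (ξ ω, -η ω)) Pr),
    Measure.map_map hemb.measurable (hξ.prodMk hη),
    Measure.map_map hemb.measurable (hξ.prodMk hη')]
  exact congrArg _ key

end Shift

/-! ### The groups `ℤ(q^k)` and `ℤ_q` -/

section Components

/-- The common properties of the groups `ℤ(q ^ k)`, `ℤ_q` and `ℤ(q^∞)`. -/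
structure IsPadicLike (q : ℕ) (A : Type*) [AddCommGroup A] [TopologicalSpace A] : Prop where
  approx : ∀ β : A →+ A, Continuous β → ∀ x, ∀ U ∈ 𝓝 (0 : A), ∃ k m : ℕ, ∀ m' : ℕ,
    m' ≡ m [MOD q ^ k] → m' • x - β x ∈ U
  dichotomy : ∀ β : A →+ A, Continuous β →
    (∀ x, Tendsto (fun n : ℕ => β^[n.factorial] x) atTop (𝓝 x)) ∨
      ∀ x, Tendsto (fun n : ℕ => β^[n.factorial] x) atTop (𝓝 0)
  divide : ∀ N : ℕ, N.Coprime q → ∃ h : A →+ A, Continuous h ∧ ∀ x, N • h x = x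
  separates : ∀ x : A, x ≠ 0 → ∃ χ : AddChar A Circle, Continuous χ ∧ χ x ≠ 1
  polish : PolishSpace A

theorem IsPadicLike.of_equiv {q : ℕ} {A B : Type*} [AddCommGroup A] [TopologicalSpace A]
    [AddCommGroup B] [TopologicalSpace B] (hB : IsPadicLike q B) (e : A ≃ₜ+ B) :
    IsPadicLike q A where
  approx β hβ x U hU := by
    have hes : Continuous e.symm := e.symm.continuous
    obtain ⟨k, m, h⟩ := hB.approx ((e : A →+ B).comp (β.comp (e.symm : B →+ A)))
      (e.continuous.comp (hβ.comp e.symm.continuous)) (e x) (e.symm ⁻¹' U)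
      (hes.continuousAt.preimage_mem_nhds (by simpa using hU))
    refine ⟨k, m, fun m' hm' => ?_⟩
    have := h m' hm'
    simpa using this
  dichotomy β hβ := by
    have hes : Continuous e.symm := e.symm.continuous
    have hit : ∀ n x, e.symm (((e : A →+ B).comp (β.comp (e.symm : B →+ A)))^[n] (e x)) =
        β^[n] x := by
      intro n x
      induction n generalizing x with
      | zero => simp
      | succ n ih =>
        rw [Function.iterate_succ_apply, Function.iterate_succ_apply, ← ih]
        simp
    refine (hB.dichotomy ((e : A →+ B).comp (β.comp (e.symm : B →+ A)))
      (e.continuous.comp (hβ.comp e.symm.continuous))).imp (fun h x => ?_) (fun h x => ?_)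
    · have := (hes.tendsto _).comp (h (e x))
      rw [e.symm_apply_apply] at this
      exact this.congr fun n => hit _ x
    · have := (hes.tendsto _).comp (h (e x))
      rw [map_zero] at this
      exact this.congr fun n => hit _ x
  divide N hN := by
    obtain ⟨h, hc, hh⟩ := hB.divide N hN
    refine ⟨(e.symm : B →+ A).comp (h.comp (e : A →+ B)),
      e.symm.continuous.comp (hc.comp e.continuous), fun x => ?_⟩
    apply e.injective
    simp [hh]
  separates x hx := by
    obtain ⟨χ, hχ, hne⟩ := hB.separates (e x) (by simpa using hx)
    exact ⟨χ.compAddMonoidHom (e : A →+ B), hχ.comp e.continuous, by simpa using hne⟩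
  polish :=
    have := hB.polish
    e.toHomeomorph.isClosedEmbedding.polishSpace

theorem addMonoidHom_zmod_apply {N : ℕ} [NeZero N] (β : ZMod N →+ ZMod N) (x : ZMod N) :
    β x = β 1 * x := by
  have : β (x.val • (1 : ZMod N)) = x.val • β 1 := map_nsmul _ _ _
  rw [nsmul_one, ZMod.natCast_zmod_val, nsmul_eq_mul, ZMod.natCast_zmod_val] at this
  rw [this, mul_comm]

theorem iterate_eq_pow_mul {R : Type*} [CommRing R] {β : R →+ R} {u : R}
    (h : ∀ x, β x = u * x) (n : ℕ) (x : R) : β^[n] x = u ^ n * x := by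
  induction n with
  | zero => simp
  | succ n ih => rw [Function.iterate_succ_apply', ih, h, pow_succ']; ring

/-- The reason for factorial exponents: `n!` is divisible by the order of any given unit once `n` is
large. -/
theorem tendsto_pow_factorial_of_isUnit {R : Type*} [Monoid R] [Finite R] {u : R}
    (h : IsUnit u) : ∀ᶠ n : ℕ in atTop, u ^ n.factorial = 1 := by
  obtain ⟨v, rfl⟩ := h
  filter_upwards [eventually_ge_atTop (orderOf v)] with n hn
  rw [← Units.val_pow_eq_pow_val, orderOf_dvd_iff_pow_eq_one.1
    (Nat.dvd_factorial (orderOf_pos v) hn), Units.val_one]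

theorem isPadicLike_zmod {q : ℕ} (hq : q.Prime) (k : ℕ) : IsPadicLike q (ZMod (q ^ k)) where
  approx β hβ x U hU := by
    have : NeZero (q ^ k) := ⟨pow_ne_zero _ hq.ne_zero⟩
    refine ⟨k, (β 1).val, fun m' hm' => ?_⟩
    have h : (m' : ZMod (q ^ k)) = β 1 := by
      rw [(ZMod.natCast_eq_natCast_iff _ _ _).2 hm', ZMod.natCast_zmod_val]
    rw [addMonoidHom_zmod_apply β x, nsmul_eq_mul, h, sub_self]
    exact mem_of_mem_nhds hU
  dichotomy β hβ := by
    have : NeZero (q ^ k) := ⟨pow_ne_zero _ hq.ne_zero⟩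
    have hit := iterate_eq_pow_mul (addMonoidHom_zmod_apply β)
    by_cases hu : IsUnit (β 1)
    · left
      intro x
      refine tendsto_const_nhds.congr' ?_
      filter_upwards [tendsto_pow_factorial_of_isUnit hu] with n hn
      rw [hit, hn, one_mul]
    · right
      intro x
      have hd : q ∣ (β 1).val := by
        by_contra hd
        apply hu
        rw [← ZMod.natCast_zmod_val (β 1), ZMod.isUnit_iff_coprime]
        exact Nat.Coprime.pow_right _ ((Nat.Prime.coprime_iff_not_dvd hq).2 hd).symm
      refine tendsto_const_nhds.congr' ?_
      filter_upwards [eventually_ge_atTop k] with n hn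
      have h0 : (β 1) ^ n.factorial = 0 := by
        rw [← ZMod.natCast_zmod_val (β 1), ← Nat.cast_pow, ZMod.natCast_eq_zero_iff]
        exact (pow_dvd_pow q (hn.trans n.self_le_factorial)).trans (pow_dvd_pow_of_dvd hd _)
      rw [hit, h0, zero_mul]
  divide N hN := by
    have hu : IsUnit (N : ZMod (q ^ k)) :=
      (ZMod.isUnit_iff_coprime _ _).2 (Nat.Coprime.pow_right _ hN)
    obtain ⟨v, hv⟩ := hu
    refine ⟨AddMonoidHom.mulLeft (↑v⁻¹ : ZMod (q ^ k)), continuous_of_discreteTopology,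
      fun x => ?_⟩
    rw [nsmul_eq_mul, ← hv, AddMonoidHom.coe_mulLeft, Units.mul_inv_cancel_left]
  separates x hx := by
    have : NeZero (q ^ k) := ⟨pow_ne_zero _ hq.ne_zero⟩
    refine ⟨ZMod.toCircle, continuous_of_discreteTopology, fun h => hx ?_⟩
    exact ZMod.injective_toCircle (h.trans (AddChar.map_zero_eq_one _).symm)
  polish := by
    have : NeZero (q ^ k) := ⟨pow_ne_zero _ hq.ne_zero⟩
    infer_instance

/-- Both sides are continuous and agree on the natural numbers, which are dense. -/
theorem addMonoidHom_padicInt_apply {q : ℕ} [Fact q.Prime] (β : ℤ_[q] →+ ℤ_[q])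
    (hβ : Continuous β) (x : ℤ_[q]) : β x = β 1 * x := by
  refine congr_fun (PadicInt.denseRange_natCast.equalizer hβ (continuous_const.mul continuous_id)
    ?_) x
  ext n
  have : β (n • (1 : ℤ_[q])) = n • β 1 := map_nsmul _ _ _
  change β (n : ℤ_[q]) = β 1 * (n : ℤ_[q])
  rw [nsmul_one, nsmul_eq_mul] at this
  rw [this, mul_comm]

theorem PadicInt.exists_norm_le_mem_nhds {q : ℕ} [hq : Fact q.Prime] {x : ℤ_[q]} {U : Set ℤ_[q]}
    (hU : U ∈ 𝓝 x) : ∃ k : ℕ, ∀ y, y - x ∈ Ideal.span {(q : ℤ_[q]) ^ k} → y ∈ U := by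
  obtain ⟨ε, hε, h⟩ := Metric.mem_nhds_iff.1 hU
  obtain ⟨k, hk⟩ := PadicInt.exists_pow_neg_lt q hε
  refine ⟨k, fun y hy => h ?_⟩
  rw [Metric.mem_ball, dist_eq_norm]
  exact ((PadicInt.norm_le_pow_iff_mem_span_pow _ _).2 hy).trans_lt hk

theorem PadicInt.continuous_toZModPow {q : ℕ} [hq : Fact q.Prime] (k : ℕ) :
    Continuous (PadicInt.toZModPow k : ℤ_[q] →+* ZMod (q ^ k)) := by
  refine continuous_of_continuousAt_zero (PadicInt.toZModPow k : ℤ_[q] →+* ZMod (q ^ k)) ?_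
  rw [ContinuousAt, map_zero, nhds_discrete (ZMod (q ^ k)), tendsto_pure]
  filter_upwards [Metric.ball_mem_nhds (0 : ℤ_[q])
    (ε := (q : ℝ) ^ (-k : ℤ)) (by have := hq.out.pos; positivity)] with x hx
  rw [← RingHom.mem_ker, PadicInt.ker_toZModPow, ← PadicInt.norm_le_pow_iff_mem_span_pow]
  rw [Metric.mem_ball, dist_zero_right] at hx
  exact hx.le

theorem isPadicLike_padicInt (q : ℕ) [hq : Fact q.Prime] : IsPadicLike q ℤ_[q] where
  approx β hβ x U hU := by
    obtain ⟨k, hk⟩ := PadicInt.exists_norm_le_mem_nhds hU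
    refine ⟨k, (β 1).appr k, fun m' hm' => hk _ ?_⟩
    rw [addMonoidHom_padicInt_apply β hβ x, nsmul_eq_mul, ← sub_mul, sub_zero]
    refine Ideal.mul_mem_right _ _ ?_
    have h1 := PadicInt.appr_spec k (β 1)
    have h2 : ((m' : ℤ_[q]) - ((β 1).appr k : ℕ)) ∈ Ideal.span {(q : ℤ_[q]) ^ k} := by
      rw [Ideal.mem_span_singleton]
      obtain ⟨d, hd⟩ := (Nat.modEq_iff_dvd.1 hm'.symm)
      refine ⟨d, ?_⟩
      have := congrArg (Int.cast : ℤ → ℤ_[q]) hd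
      push_cast at this
      exact this
    have := Ideal.sub_mem _ h2 h1
    simpa using this
  dichotomy β hβ := by
    have hit := iterate_eq_pow_mul (addMonoidHom_padicInt_apply β hβ)
    by_cases hu : IsUnit (β 1)
    · left
      intro x
      have h1 : Tendsto (fun n : ℕ => (β 1) ^ n.factorial) atTop (𝓝 1) := by
        refine tendsto_def.2 fun U hU => ?_
        obtain ⟨k, hk⟩ := PadicInt.exists_norm_le_mem_nhds hU
        have : NeZero (q ^ k) := ⟨pow_ne_zero _ hq.out.ne_zero⟩
        filter_upwards [tendsto_pow_factorial_of_isUnit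
          (hu.map (PadicInt.toZModPow k : ℤ_[q] →+* ZMod (q ^ k)))] with n hn
        apply hk
        rw [← PadicInt.ker_toZModPow, RingHom.mem_ker, map_sub, map_pow, hn, map_one, sub_self]
      have h2 := h1.mul_const x
      rw [one_mul] at h2
      exact h2.congr fun n => (hit _ _).symm
    · right
      intro x
      have h1 : ‖β 1‖ < 1 :=
        lt_of_le_of_ne (PadicInt.norm_le_one _) fun h => hu (PadicInt.isUnit_iff.2 h)
      have h2 := ((tendsto_pow_atTop_nhds_zero_of_norm_lt_one h1).comp
        (tendsto_atTop_mono Nat.self_le_factorial tendsto_id)).mul_const x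
      rw [zero_mul] at h2
      exact h2.congr fun n => (hit _ _).symm
  divide N hN := by
    have hu : IsUnit (N : ℤ_[q]) := by
      rw [PadicInt.isUnit_iff, PadicInt.norm_natCast_eq_one_iff]
      exact hN.symm
    obtain ⟨v, hv⟩ := hu
    refine ⟨AddMonoidHom.mulLeft (↑v⁻¹ : ℤ_[q]), continuous_const.mul continuous_id, fun x => ?_⟩
    rw [nsmul_eq_mul, ← hv, AddMonoidHom.coe_mulLeft, Units.mul_inv_cancel_left]
  separates x hx := by
    have : ∃ k, PadicInt.toZModPow k x ≠ 0 := by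
      by_contra! h
      refine hx (PadicInt.ext_of_toZModPow.1 fun n => ?_)
      rw [h, map_zero]
    obtain ⟨k, hk⟩ := this
    have : NeZero (q ^ k) := ⟨pow_ne_zero _ hq.out.ne_zero⟩
    refine ⟨ZMod.toCircle.compAddMonoidHom
      ((PadicInt.toZModPow k : ℤ_[q] →+* ZMod (q ^ k)) : ℤ_[q] →+ ZMod (q ^ k)),
      (continuous_of_discreteTopology (f := fun z : ZMod (q ^ k) => ZMod.toCircle z)).comp
        (PadicInt.continuous_toZModPow k), fun h => hk ?_⟩
    exact ZMod.injective_toCircle (h.trans (AddChar.map_zero_eq_one _).symm)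
  polish := by infer_instance

theorem HeydeQuasicyclic.IsCyclicOrPadic.isPadicLike {q : ℕ} (hq : q.Prime) {A : Type*} [AddCommGroup A]
    [TopologicalSpace A] (h : IsCyclicOrPadic q A) : IsPadicLike q A := by
  rcases h with ⟨k, ⟨e⟩⟩ | ⟨_, ⟨e⟩⟩
  · exact (isPadicLike_zmod hq k).of_equiv e
  · exact (isPadicLike_padicInt q).of_equiv e

theorem HeydeQuasicyclic.IsCyclicOrPadic.compactSpace {q : ℕ} (hq : q.Prime) {A : Type*} [AddCommGroup A]
    [TopologicalSpace A] (h : IsCyclicOrPadic q A) : CompactSpace A := by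
  rcases h with ⟨k, ⟨e⟩⟩ | ⟨_, ⟨e⟩⟩
  · have : NeZero (q ^ k) := ⟨pow_ne_zero _ hq.ne_zero⟩
    exact e.toHomeomorph.symm.compactSpace
  · exact e.toHomeomorph.symm.compactSpace

/-- Used to show that other coordinates cannot map nontrivially into the `q`-coordinate. -/
theorem HeydeQuasicyclic.IsCyclicOrPadic.eq_zero_of_divisible {q : ℕ} {A : Type*} [AddCommGroup A]
    [TopologicalSpace A] (h : IsCyclicOrPadic q A) {z : A} (hz : ∀ n : ℕ, ∃ w : A, q ^ n • w = z) :
    z = 0 := by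
  rcases h with ⟨k, ⟨e⟩⟩ | ⟨hF, ⟨e⟩⟩
  · obtain ⟨w, rfl⟩ := hz k
    apply e.injective
    rw [map_nsmul, map_zero, nsmul_eq_mul, ZMod.natCast_self, zero_mul]
  · apply e.injective
    rw [map_zero]
    refine PadicInt.ext_of_toZModPow.1 fun n => ?_
    obtain ⟨w, rfl⟩ := hz n
    rw [map_nsmul, map_nsmul, map_zero, nsmul_eq_mul, ZMod.natCast_self, zero_mul]

end Components

/-! ### The quasicyclic group -/

section QuasicyclicGroup

variable {p : ℕ}

theorem quasicyclic_torsion (s : Quasicyclic p) : ∃ n : ℕ, p ^ n • s = 0 := by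
  obtain ⟨n, hn⟩ := s.2
  exact ⟨n, Subtype.ext hn⟩

/-- The class of `1 / p ^ n`. -/
def quasicyclicGen (hp : p ≠ 0) (n : ℕ) : Quasicyclic p :=
  ⟨((1 / (p : ℚ) ^ n : ℚ) : ℚ ⧸ AddSubgroup.zmultiples (1 : ℚ)), n, by
    rw [← QuotientAddGroup.mk_nsmul, QuotientAddGroup.eq_zero_iff]
    refine ⟨1, ?_⟩
    have : (p : ℚ) ≠ 0 := by exact_mod_cast hp
    simp [this]⟩

theorem exists_nsmul_quasicyclicGen (hp : p ≠ 0) {n : ℕ} {s : Quasicyclic p}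
    (hs : p ^ n • s = 0) : ∃ j : ℕ, s = j • quasicyclicGen hp n := by
  have hp' : (p : ℚ) ≠ 0 := by exact_mod_cast hp
  obtain ⟨s, hs'⟩ := s
  induction s using QuotientAddGroup.induction_on with
  | H r =>
    have h0 : p ^ n • ((r : ℚ) : ℚ ⧸ AddSubgroup.zmultiples (1 : ℚ)) = 0 :=
      congrArg Subtype.val hs
    rw [← QuotientAddGroup.mk_nsmul, QuotientAddGroup.eq_zero_iff] at h0
    obtain ⟨i, hi⟩ := h0
    have hi' : (i : ℚ) = p ^ n * r := by simpa using hi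
    have hpos : (0 : ℤ) < (p : ℤ) ^ n := by positivity
    refine ⟨(i % (p : ℤ) ^ n).toNat, Subtype.ext ?_⟩
    change ((r : ℚ) : ℚ ⧸ AddSubgroup.zmultiples (1 : ℚ)) = (i % (p : ℤ) ^ n).toNat •
      ((1 / (p : ℚ) ^ n : ℚ) : ℚ ⧸ AddSubgroup.zmultiples (1 : ℚ))
    rw [← QuotientAddGroup.mk_nsmul, QuotientAddGroup.eq]
    refine ⟨-(i / (p : ℤ) ^ n), ?_⟩
    have h1 : (((i % (p : ℤ) ^ n).toNat : ℕ) : ℚ) = ((i % (p : ℤ) ^ n : ℤ) : ℚ) := by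
      rw [← Int.cast_natCast, Int.toNat_of_nonneg (Int.emod_nonneg _ hpos.ne')]
    have h2 : ((i % (p : ℤ) ^ n : ℤ) : ℚ) = i - p ^ n * ((i / (p : ℤ) ^ n : ℤ) : ℚ) := by
      rw [Int.emod_def]
      push_cast
      ring
    simp only [zsmul_eq_mul, nsmul_eq_mul, mul_one]
    rw [h1, h2, hi']
    push_cast
    field_simp
    ring

theorem pow_nsmul_quasicyclicGen (hp : p ≠ 0) (n : ℕ) : p ^ n • quasicyclicGen hp n = 0 := by
  have hp' : (p : ℚ) ≠ 0 := by exact_mod_cast hp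
  apply Subtype.ext
  change p ^ n • ((1 / (p : ℚ) ^ n : ℚ) : ℚ ⧸ AddSubgroup.zmultiples (1 : ℚ)) = 0
  rw [← QuotientAddGroup.mk_nsmul, QuotientAddGroup.eq_zero_iff]
  exact ⟨1, by simp [hp']⟩

theorem nsmul_quasicyclicGen_succ (hp : p ≠ 0) (n : ℕ) :
    p • quasicyclicGen hp (n + 1) = quasicyclicGen hp n := by
  have hp' : (p : ℚ) ≠ 0 := by exact_mod_cast hp
  apply Subtype.ext
  change p • ((1 / (p : ℚ) ^ (n + 1) : ℚ) : ℚ ⧸ AddSubgroup.zmultiples (1 : ℚ)) =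
    ((1 / (p : ℚ) ^ n : ℚ) : ℚ ⧸ AddSubgroup.zmultiples (1 : ℚ))
  rw [← QuotientAddGroup.mk_nsmul, nsmul_eq_mul]
  congr 1
  field_simp
  rw [pow_succ']

theorem quasicyclicGen_one_ne_zero (hp : p.Prime) : quasicyclicGen hp.ne_zero 1 ≠ 0 := by
  intro h
  have h0 : ((1 / (p : ℚ) ^ 1 : ℚ) : ℚ ⧸ AddSubgroup.zmultiples (1 : ℚ)) = 0 :=
    congrArg Subtype.val h
  rw [QuotientAddGroup.eq_zero_iff] at h0
  obtain ⟨i, hi⟩ := h0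
  have hp' : (p : ℚ) ≠ 0 := by exact_mod_cast hp.ne_zero
  have h1 : (i : ℚ) * p = 1 := by
    have : (i : ℚ) = 1 / p := by simpa using hi
    rw [this]
    field_simp
  have h2 : i * (p : ℤ) = 1 := by exact_mod_cast h1
  have h3 : (p : ℤ) ∣ 1 := ⟨i, by rw [← h2]; ring⟩
  exact hp.one_lt.ne' (by exact_mod_cast Int.eq_one_of_dvd_one (by positivity) h3)

theorem exists_nsmul_eq_quasicyclic (hp : p ≠ 0) (s : Quasicyclic p) : ∃ t, p • t = s := by
  obtain ⟨n, hn⟩ := quasicyclic_torsion s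
  obtain ⟨j, rfl⟩ := exists_nsmul_quasicyclicGen hp hn
  exact ⟨j • quasicyclicGen hp (n + 1), by rw [smul_comm, nsmul_quasicyclicGen_succ]⟩

theorem exists_pow_nsmul_eq_quasicyclic (hp : p ≠ 0) (n : ℕ) (s : Quasicyclic p) :
    ∃ t, p ^ n • t = s := by
  induction n generalizing s with
  | zero => exact ⟨s, by simp⟩
  | succ n ih =>
    obtain ⟨t, rfl⟩ := exists_nsmul_eq_quasicyclic hp s
    obtain ⟨u, rfl⟩ := ih t
    exact ⟨u, by rw [pow_succ', mul_smul]⟩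

theorem nsmul_eq_of_modEq {A : Type*} [AddCommGroup A] {N m m' : ℕ} {s : A} (hs : N • s = 0)
    (h : m' ≡ m [MOD N]) : m' • s = m • s := by
  rw [← Nat.mod_add_div m' N, ← Nat.mod_add_div m N, h]
  simp [add_smul, mul_comm N, mul_smul, hs]

theorem finite_quasicyclic_torsion (hp : p ≠ 0) (n : ℕ) :
    {s : Quasicyclic p | p ^ n • s = 0}.Finite := by
  refine ((Finset.range (p ^ n)).finite_toSet.image fun j : ℕ => j • quasicyclicGen hp n).subset ?_
  intro s hs
  obtain ⟨j, rfl⟩ := exists_nsmul_quasicyclicGen hp hs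
  refine ⟨j % p ^ n, ?_, ?_⟩
  · simpa using Nat.mod_lt _ (by positivity)
  · exact nsmul_eq_of_modEq (pow_nsmul_quasicyclicGen hp n) (Nat.mod_modEq _ _)

theorem nsmul_eq_zero_of_coprime {A : Type*} [AddCommGroup A] {N M : ℕ} (h : N.Coprime M) {s : A}
    (hN : N • s = 0) (hM : M • s = 0) : s = 0 := by
  have h1 := Nat.dvd_gcd (addOrderOf_dvd_of_nsmul_eq_zero hN) (addOrderOf_dvd_of_nsmul_eq_zero hM)
  rw [h, Nat.dvd_one, AddMonoid.addOrderOf_eq_one_iff] at h1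
  exact h1

theorem exists_nsmul_eq_of_coprime {A : Type*} [AddCommGroup A] {N M : ℕ} (h : N.Coprime M) {s : A}
    (hM : M • s = 0) : ∃ u : ℤ, N • (u • s) = s := by
  obtain ⟨u, v, huv⟩ := Nat.isCoprime_iff_coprime.2 h
  refine ⟨u, ?_⟩
  calc N • (u • s) = (u * N + v * M : ℤ) • s := by
        rw [add_smul, mul_smul v, natCast_zsmul s M, hM, smul_zero, add_zero, mul_smul,
          natCast_zsmul, smul_comm]
    _ = s := by rw [huv, one_smul]

/-- An element of exact order `p^(k+1)` is a multiple of `1/p^(k+1)` prime to `p`, so it generates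
all `p^(k+1)`-torsion. Unbounded orders therefore exhaust the group. -/
theorem addSubgroup_quasicyclic (hp : p.Prime) (N : AddSubgroup (Quasicyclic p)) :
    (∃ n : ℕ, ∀ s ∈ N, p ^ n • s = 0) ∨ N = ⊤ := by
  by_cases h : ∃ n : ℕ, ∀ s ∈ N, p ^ n • s = 0
  · exact Or.inl h
  · right
    push Not at h
    rw [eq_top_iff]
    intro t _
    obtain ⟨n, hn⟩ := quasicyclic_torsion t
    obtain ⟨s, hsN, hs⟩ := h n
    classical
    have hex := quasicyclic_torsion s
    have hm : p ^ Nat.find hex • s = 0 := Nat.find_spec hex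
    have hlt : n < Nat.find hex := by
      by_contra hle
      obtain ⟨d, hd⟩ := Nat.exists_eq_add_of_le (not_lt.1 hle)
      exact hs (by rw [hd, add_comm, pow_add, mul_smul, hm, smul_zero])
    obtain ⟨k, hk⟩ := Nat.exists_eq_succ_of_ne_zero (Nat.ne_zero_of_lt hlt)
    have hmin : p ^ k • s ≠ 0 := Nat.find_min hex (hk ▸ Nat.lt_succ_self k)
    rw [hk] at hm hlt
    obtain ⟨j, hj⟩ := exists_nsmul_quasicyclicGen hp.ne_zero hm
    have hgen := pow_nsmul_quasicyclicGen hp.ne_zero (k + 1)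
    have hd : ¬ p ∣ j := by
      rintro ⟨d, rfl⟩
      apply hmin
      rw [hj, ← mul_smul, ← mul_assoc, ← pow_succ, mul_comm, mul_smul, hgen, smul_zero]
    obtain ⟨u, hu⟩ := exists_nsmul_eq_of_coprime
      (Nat.Coprime.pow_right (k + 1) ((Nat.Prime.coprime_iff_not_dvd hp).2 hd).symm) hgen
    have hgN : quasicyclicGen hp.ne_zero (k + 1) ∈ N := by
      rw [← hu, smul_comm, ← hj]
      exact N.zsmul_mem hsN u
    have ht : p ^ (k + 1) • t = 0 := by
      obtain ⟨d, hd⟩ := Nat.exists_eq_add_of_le hlt.le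
      rw [show k + 1 = d + n by rw [add_comm d]; exact hd, pow_add, mul_smul, hn, smul_zero]
    obtain ⟨i, rfl⟩ := exists_nsmul_quasicyclicGen hp.ne_zero ht
    exact N.nsmul_mem hgN i

theorem exists_nsmul_quasicyclic_endo (hp : p ≠ 0) (β : Quasicyclic p →+ Quasicyclic p) (n : ℕ) :
    ∃ m : ℕ, ∀ s, p ^ n • s = 0 → β s = m • s := by
  have h0 : p ^ n • β (quasicyclicGen hp n) = 0 := by
    rw [← map_nsmul, pow_nsmul_quasicyclicGen, map_zero]
  obtain ⟨m, hm⟩ := exists_nsmul_quasicyclicGen hp h0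
  refine ⟨m, fun s hs => ?_⟩
  obtain ⟨j, rfl⟩ := exists_nsmul_quasicyclicGen hp hs
  rw [map_nsmul, hm, smul_comm]

theorem iterate_quasicyclic_endo {β : Quasicyclic p →+ Quasicyclic p} {n m : ℕ}
    (h : ∀ s, p ^ n • s = 0 → β s = m • s) (N : ℕ) {s : Quasicyclic p} (hs : p ^ n • s = 0) :
    β^[N] s = m ^ N • s := by
  induction N with
  | zero => simp
  | succ N ih =>
    rw [Function.iterate_succ_apply', ih, map_nsmul, h s hs, ← mul_smul, pow_succ]

/-- The embedding of `ℤ(p^∞)` into the circle group. -/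
theorem exists_injective_addChar_quasicyclic (p : ℕ) :
    ∃ χ : AddChar (Quasicyclic p) Circle, Function.Injective χ := by
  let φ : ℚ →+ AddCircle (1 : ℝ) :=
    (QuotientAddGroup.mk' (AddSubgroup.zmultiples (1 : ℝ))).comp (Rat.castHom ℝ : ℚ →+ ℝ)
  have hφ : ∀ r, φ r = 0 ↔ r ∈ AddSubgroup.zmultiples (1 : ℚ) := by
    intro r
    change (((r : ℝ)) : AddCircle (1 : ℝ)) = 0 ↔ _
    rw [AddCircle.coe_eq_zero_iff, AddSubgroup.mem_zmultiples_iff]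
    refine exists_congr fun n => ?_
    simp only [zsmul_eq_mul, mul_one]
    exact_mod_cast Iff.rfl
  let ψ := QuotientAddGroup.lift (AddSubgroup.zmultiples (1 : ℚ)) φ fun r hr => (hφ r).2 hr
  have hψ : Function.Injective ψ := by
    rw [injective_iff_map_eq_zero]
    intro s
    induction s using QuotientAddGroup.induction_on with
    | H r =>
      intro h
      rw [QuotientAddGroup.eq_zero_iff]
      exact (hφ r).1 h
  refine ⟨(AddCircle.toCircle_addChar (T := 1)).compAddMonoidHom
    (ψ.comp (quasicyclicSubgroup p).subtype), fun s t h => ?_⟩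
  exact Subtype.ext (hψ (AddCircle.injective_toCircle one_ne_zero h))

theorem isPadicLike_quasicyclic (hp : p.Prime) : IsPadicLike p (Quasicyclic p) where
  approx β hβ x U hU := by
    obtain ⟨k, hk⟩ := quasicyclic_torsion x
    obtain ⟨m, hm⟩ := exists_nsmul_quasicyclic_endo hp.ne_zero β k
    refine ⟨k, m, fun m' hm' => ?_⟩
    rw [hm x hk, nsmul_eq_of_modEq hk hm', sub_self]
    exact mem_of_mem_nhds hU
  dichotomy β hβ := by
    have hp1 : p • quasicyclicGen hp.ne_zero 1 = 0 := by
      simpa using pow_nsmul_quasicyclicGen hp.ne_zero 1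
    have hm1 : ∀ {k m : ℕ}, (∀ s, p ^ (k + 1) • s = 0 → β s = m • s) →
        β (quasicyclicGen hp.ne_zero 1) = m • quasicyclicGen hp.ne_zero 1 := fun {k m} h =>
      h _ (by
        rw [pow_succ, mul_smul, hp1, smul_zero])
    -- On `p^(k+1)`-torsion `β` is multiplication by some `m`. Whether `p ∣ m` is read off from the
    -- value at `1/p`, hence does not depend on `k`.
    by_cases h0 : β (quasicyclicGen hp.ne_zero 1) = 0
    · right
      intro x
      obtain ⟨k, hk⟩ := quasicyclic_torsion x
      have hk' : p ^ (k + 1) • x = 0 := by rw [pow_succ', mul_smul, hk, smul_zero]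
      obtain ⟨m, hm⟩ := exists_nsmul_quasicyclic_endo hp.ne_zero β (k + 1)
      have hd : p ∣ m := by
        by_contra hd
        exact quasicyclicGen_one_ne_zero hp (nsmul_eq_zero_of_coprime
          ((Nat.Prime.coprime_iff_not_dvd hp).2 hd) hp1 ((hm1 hm).symm.trans h0))
      refine tendsto_const_nhds.congr' ?_
      filter_upwards [eventually_ge_atTop k] with n hn
      rw [iterate_quasicyclic_endo hm _ hk']
      obtain ⟨d, hd⟩ := (pow_dvd_pow p (hn.trans n.self_le_factorial)).trans
        (pow_dvd_pow_of_dvd hd _)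
      rw [hd, mul_comm, mul_smul, hk, smul_zero]
    · left
      intro x
      obtain ⟨k, hk⟩ := quasicyclic_torsion x
      have hk' : p ^ (k + 1) • x = 0 := by rw [pow_succ', mul_smul, hk, smul_zero]
      obtain ⟨m, hm⟩ := exists_nsmul_quasicyclic_endo hp.ne_zero β (k + 1)
      have hd : ¬ p ∣ m := by
        rintro ⟨d, rfl⟩
        apply h0
        rw [hm1 hm, mul_comm, mul_smul, hp1, smul_zero]
      have hcop : m.Coprime (p ^ (k + 1)) :=
        Nat.Coprime.pow_right _ ((Nat.Prime.coprime_iff_not_dvd hp).2 hd).symm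
      refine tendsto_const_nhds.congr' ?_
      filter_upwards [eventually_ge_atTop (p ^ (k + 1)).totient] with n hn
      rw [iterate_quasicyclic_endo hm _ hk']
      obtain ⟨d, hd⟩ := Nat.dvd_factorial (Nat.totient_pos.2 (pow_pos hp.pos _)) hn
      have h1 : m ^ n.factorial ≡ 1 [MOD p ^ (k + 1)] := by
        rw [hd, pow_mul]
        simpa using (Nat.ModEq.pow_totient hcop).pow d
      rw [nsmul_eq_of_modEq hk' h1, one_smul]
  divide N hN := by
    have hbij : Function.Bijective (nsmulAddMonoidHom (α := Quasicyclic p) N) := by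
      refine ⟨(injective_iff_map_eq_zero _).2 fun s hs => ?_, fun s => ?_⟩
      · obtain ⟨k, hk⟩ := quasicyclic_torsion s
        exact nsmul_eq_zero_of_coprime (hN.pow_right k) hs hk
      · obtain ⟨k, hk⟩ := quasicyclic_torsion s
        obtain ⟨u, hu⟩ := exists_nsmul_eq_of_coprime (hN.pow_right k) hk
        exact ⟨_, hu⟩
    refine ⟨(AddEquiv.ofBijective _ hbij).symm, continuous_of_discreteTopology, fun x => ?_⟩
    exact (AddEquiv.ofBijective _ hbij).apply_symm_apply x
  separates x hx := by
    obtain ⟨χ, hχ⟩ := exists_injective_addChar_quasicyclic p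
    exact ⟨χ, continuous_of_discreteTopology, fun h =>
      hx (hχ (h.trans (AddChar.map_zero_eq_one _).symm))⟩
  polish := by
    have : Countable (ℚ ⧸ AddSubgroup.zmultiples (1 : ℚ)) :=
      (QuotientAddGroup.mk_surjective).countable
    have : Countable (Quasicyclic p) := inferInstanceAs (Countable (quasicyclicSubgroup p))
    infer_instance

end QuasicyclicGroup

/-! ### Endomorphisms and closed subgroups of the product -/

section ProductStructure

open scoped Pointwise

variable {P : Set ℕ} {F : P → Type u} [∀ q, AddCommGroup (F q)] [∀ q, TopologicalSpace (F q)]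
  [∀ q, IsTopologicalAddGroup (F q)] {p : ℕ}

/-- An element with zero `q`-coordinate is divisible by every `q^n`: the other factors of `K` are
prime to `q`, and `ℤ(p^∞)` is divisible by `q^n` even if `q = p`. Its image has an infinitely
`q`-divisible `q`-coordinate, which must be 0. -/
theorem exists_coordinate_endo (hP : ∀ q ∈ P, q.Prime)
    (hF : ∀ q : P, IsCyclicOrPadic (q : ℕ) (F q)) (hp : p.Prime)
    (β : contEnd (ProductGroup F p)) (q : P) :
    ∃ γ : F q →+ F q, Continuous γ ∧ ∀ x, (β.1 x).1 q = γ (x.1 q) := by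
  classical
  have hβ := contEnd_continuous β
  refine ⟨{ toFun := fun z => (β.1 (Pi.single q z, 0)).1 q
            map_zero' := by
              rw [Pi.single_zero, ← Prod.zero_eq_mk, map_zero]
              rfl
            map_add' := fun z w => by
              rw [Pi.single_add, ← add_zero (0 : Quasicyclic p), ← Prod.mk_add_mk, map_add]
              simp }, ?_, fun x => ?_⟩
  · exact (continuous_apply q).comp (continuous_fst.comp
      (hβ.comp ((continuous_single q).prodMk continuous_const)))
  · change (β.1 x).1 q = (β.1 (Pi.single q (x.1 q), 0)).1 q
    rw [← sub_eq_zero]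
    apply (hF q).eq_zero_of_divisible
    intro n
    have hco : ∀ q' : P, q' ≠ q → ((q : ℕ) ^ n).Coprime q' := fun q' hne =>
      ((Nat.coprime_primes (hP q q.2) (hP q' q'.2)).2 fun h => hne (Subtype.ext h.symm)).pow_left n
    have hdiv : ∀ q' : P, q' ≠ q → ∃ w : F q', (q : ℕ) ^ n • w = x.1 q' := fun q' hne => by
      obtain ⟨h, -, hh⟩ := ((hF q').isPadicLike (hP q' q'.2)).divide _ (hco q' hne)
      exact ⟨_, hh _⟩
    choose w hw using hdiv
    obtain ⟨t, ht⟩ : ∃ t : Quasicyclic p, (q : ℕ) ^ n • t = x.2 := by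
      by_cases hqp : (q : ℕ) = p
      · rw [hqp]
        exact exists_pow_nsmul_eq_quasicyclic hp.ne_zero n x.2
      · obtain ⟨h, -, hh⟩ := (isPadicLike_quasicyclic hp).divide ((q : ℕ) ^ n)
          (((Nat.coprime_primes (hP q q.2) hp).2 hqp).pow_left n)
        exact ⟨_, hh _⟩
    let y : ProductGroup F p := (fun q' => if h : q' = q then 0 else w q' h, t)
    have hy : (q : ℕ) ^ n • y = x - (Pi.single q (x.1 q), 0) := by
      ext q'
      · by_cases h : q' = q
        · subst h
          simp [y]
        · simp [y, h, hw]
      · simp [y, ht]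
    refine ⟨(β.1 y).1 q, ?_⟩
    have h1 := map_nsmul β.1 ((q : ℕ) ^ n) y
    rw [hy, map_sub] at h1
    have h2 := congrArg (fun z : ProductGroup F p => z.1 q) h1
    exact h2.symm

/-- The image of the compact `K` in the discrete `ℤ(p^∞)` is finite, hence killed by some `p^B`; but
`K` is `p^B`-divisible, so the image is zero. -/
theorem exists_quasicyclic_endo (hP : ∀ q ∈ P, q.Prime)
    (hF : ∀ q : P, IsCyclicOrPadic (q : ℕ) (F q)) (hp : p.Prime) (hpP : p ∉ P)
    (β : contEnd (ProductGroup F p)) :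
    ∃ γ : Quasicyclic p →+ Quasicyclic p, ∀ x, (β.1 x).2 = γ x.2 := by
  have hβ := contEnd_continuous β
  have : ∀ q, CompactSpace (F q) := fun q => (hF q).compactSpace (hP q q.2)
  have hker : ∀ k : ∀ q, F q, (β.1 (k, 0)).2 = 0 := by
    have hcont : Continuous fun k : ∀ q, F q => (β.1 (k, 0)).2 :=
      continuous_snd.comp (hβ.comp (continuous_id.prodMk continuous_const))
    have hfin : (Set.range fun k : ∀ q, F q => (β.1 (k, 0)).2).Finite :=
      (isCompact_range hcont).finite_of_discrete
    choose e he using fun s : Quasicyclic p => quasicyclic_torsion s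
    obtain ⟨B, hB⟩ := (hfin.image e).bddAbove
    intro k
    have hdiv : ∀ q : P, ∃ w : F q, p ^ B • w = k q := fun q => by
      obtain ⟨h, -, hh⟩ := ((hF q).isPadicLike (hP q q.2)).divide (p ^ B)
        (((Nat.coprime_primes hp (hP q q.2)).2 fun h => hpP (h ▸ q.2)).pow_left B)
      exact ⟨_, hh _⟩
    choose w hw using hdiv
    have hk : ((k, 0) : ProductGroup F p) = p ^ B • (w, 0) := by
      ext q
      · simp [hw]
      · simp
    rw [hk, map_nsmul, Prod.smul_snd]
    obtain ⟨d, hd⟩ := Nat.exists_eq_add_of_le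
      (hB (Set.mem_image_of_mem e (Set.mem_range_self w)))
    rw [hd, add_comm, pow_add, mul_smul, he, smul_zero]
  refine ⟨{ toFun := fun s => (β.1 (0, s)).2
            map_zero' := by
              rw [← Prod.zero_eq_mk, map_zero]
              rfl
            map_add' := fun s t => by
              rw [← add_zero (0 : ∀ q, F q), ← Prod.mk_add_mk, map_add]
              simp }, fun x => ?_⟩
  change (β.1 x).2 = (β.1 (0, x.2)).2
  have hx : x = (x.1, 0) + (0, x.2) := by simp
  conv_lhs => rw [hx, map_add, Prod.snd_add, hker, zero_add]

theorem polishSpace_productGroup (hP : ∀ q ∈ P, q.Prime)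
    (hF : ∀ q : P, IsCyclicOrPadic (q : ℕ) (F q)) (hp : p.Prime) :
    PolishSpace (ProductGroup F p) := by
  have : ∀ q, PolishSpace (F q) := fun q => ((hF q).isPadicLike (hP q q.2)).polish
  have := (isPadicLike_quasicyclic hp).polish
  infer_instance

theorem separates_productGroup (hP : ∀ q ∈ P, q.Prime)
    (hF : ∀ q : P, IsCyclicOrPadic (q : ℕ) (F q)) (hp : p.Prime) (x : ProductGroup F p)
    (hx : x ≠ 0) : ∃ χ : AddChar (ProductGroup F p) Circle, Continuous χ ∧ χ x ≠ 1 := by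
  by_cases h2 : x.2 = 0
  · have : ∃ q, x.1 q ≠ 0 := by
      by_contra! h
      exact hx (Prod.ext (funext h) h2)
    obtain ⟨q, hq⟩ := this
    obtain ⟨χ, hχ, hne⟩ := ((hF q).isPadicLike (hP q q.2)).separates _ hq
    exact ⟨χ.compAddMonoidHom ((Pi.evalAddMonoidHom F q).comp (AddMonoidHom.fst _ _)),
      hχ.comp ((continuous_apply q).comp continuous_fst), hne⟩
  · obtain ⟨χ, hχ, hne⟩ := (isPadicLike_quasicyclic hp).separates _ h2
    exact ⟨χ.compAddMonoidHom (AddMonoidHom.snd _ _), hχ.comp continuous_snd, hne⟩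

/-- A basic neighbourhood restricts finitely many coordinates. In each, `βx` is approximated by `N •
x` under a congruence on `N` modulo a prime power; the primes differ, so one `N` serves all. -/
theorem apply_mem_closed_subgroup (hP : ∀ q ∈ P, q.Prime)
    (hF : ∀ q : P, IsCyclicOrPadic (q : ℕ) (F q)) (hp : p.Prime) (hpP : p ∉ P)
    (H : AddSubgroup (ProductGroup F p)) (hH : IsClosed (H : Set (ProductGroup F p)))
    (β : contEnd (ProductGroup F p)) (x : ProductGroup F p) (hx : x ∈ H) : β.1 x ∈ H := by
  classical
  rw [← SetLike.mem_coe, ← hH.closure_eq, mem_closure_iff_nhds]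
  intro U hU
  rw [nhds_prod_eq, Filter.mem_prod_iff] at hU
  obtain ⟨u, hu, v, hv, huv⟩ := hU
  rw [nhds_pi, Filter.mem_pi] at hu
  obtain ⟨I, hI, t, ht, hIt⟩ := hu
  have happ : ∀ q : P, ∃ k m : ℕ, ∀ m' : ℕ, m' ≡ m [MOD (q : ℕ) ^ k] → m' • x.1 q ∈ t q := by
    intro q
    obtain ⟨γ, hγ, hγx⟩ := exists_coordinate_endo hP hF hp β q
    have hU : (fun z => z + (β.1 x).1 q) ⁻¹' t q ∈ 𝓝 (0 : F q) :=
      (continuous_add_const _).continuousAt.preimage_mem_nhds (by simpa using ht q)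
    obtain ⟨k, m, h⟩ := ((hF q).isPadicLike (hP q q.2)).approx γ hγ (x.1 q) _ hU
    refine ⟨k, m, fun m' hm' => ?_⟩
    have := h m' hm'
    rwa [Set.mem_preimage, hγx, sub_add_cancel] at this
  choose k m hkm using happ
  obtain ⟨γ, hγx⟩ := exists_quasicyclic_endo hP hF hp hpP β
  have hV : (fun z => z + (β.1 x).2) ⁻¹' v ∈ 𝓝 (0 : Quasicyclic p) :=
    (continuous_add_const _).continuousAt.preimage_mem_nhds (by simpa using hv)
  obtain ⟨k₀, m₀, h₀⟩ := (isPadicLike_quasicyclic hp).approx γ continuous_of_discreteTopology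
    x.2 _ hV
  let modulus : Option P → ℕ := fun o => o.elim (p ^ k₀) fun q => (q : ℕ) ^ k q
  let residue : Option P → ℕ := fun o => o.elim m₀ m
  obtain ⟨N, hN⟩ := Nat.chineseRemainderOfFinset residue modulus
    (Finset.insertNone hI.toFinset) (by
      rintro (_ | q) _
      · exact pow_ne_zero _ hp.ne_zero
      · exact pow_ne_zero _ (hP q q.2).ne_zero) (by
      rintro (_ | q) _ (_ | q') _ hne
      · exact absurd rfl hne
      · exact Nat.Coprime.pow _ _ ((Nat.coprime_primes hp (hP q' q'.2)).2
          fun h => hpP (h ▸ q'.2))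
      · exact Nat.Coprime.pow _ _ ((Nat.coprime_primes (hP q q.2) hp).2
          fun h => hpP (h ▸ q.2))
      · exact Nat.Coprime.pow _ _ ((Nat.coprime_primes (hP q q.2) (hP q' q'.2)).2
          fun h => hne (congrArg some (Subtype.ext h))))
  refine ⟨N • x, huv ⟨hIt fun q hq => ?_, ?_⟩, H.nsmul_mem hx N⟩
  · exact hkm q N (hN (some q) (by simpa using hq))
  · have := h₀ N (hN none (by simp))
    rwa [Set.mem_preimage, hγx, sub_add_cancel] at this

/-- `Q` keeps the coordinates on which the iterates tend to the identity and kills the others, where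
they tend to 0. -/
theorem exists_limit_productGroup (hP : ∀ q ∈ P, q.Prime)
    (hF : ∀ q : P, IsCyclicOrPadic (q : ℕ) (F q)) (hp : p.Prime) (hpP : p ∉ P)
    (θ : contEnd (ProductGroup F p)) : ∃ Q : contEnd (ProductGroup F p), Q * Q = Q ∧
      ∀ x, Tendsto (fun n : ℕ => (θ ^ n.factorial).1 x) atTop (𝓝 (Q.1 x)) := by
  classical
  choose γ hγ hγx using exists_coordinate_endo hP hF hp θ
  obtain ⟨δ, hδx⟩ := exists_quasicyclic_endo hP hF hp hpP θ
  have hiter : ∀ n x q, ((θ ^ n).1 x).1 q = (γ q)^[n] (x.1 q) := by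
    intro n x q
    induction n with
    | zero => rfl
    | succ n ih =>
      rw [Function.iterate_succ_apply', ← ih, ← hγx, pow_succ']
      rfl
  have hiter' : ∀ n x, ((θ ^ n).1 x).2 = δ^[n] x.2 := by
    intro n x
    induction n with
    | zero => rfl
    | succ n ih =>
      rw [Function.iterate_succ_apply', ← ih, ← hδx, pow_succ']
      rfl
  let good : P → Prop := fun q =>
    ∀ x, Tendsto (fun n : ℕ => (γ q)^[n.factorial] x) atTop (𝓝 x)
  let good' : Prop := ∀ x, Tendsto (fun n : ℕ => δ^[n.factorial] x) atTop (𝓝 x)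
  let Q : contEnd (ProductGroup F p) :=
    ⟨{ toFun := fun x => (fun q => if good q then x.1 q else 0, if good' then x.2 else 0)
       map_zero' := by ext <;> simp
       map_add' := fun x y => by
        ext q
        · by_cases h : good q <;> simp [h]
        · by_cases h : good' <;> simp [h] }, by
      refine Continuous.prodMk (continuous_pi fun q => ?_) ?_
      · by_cases h : good q
        · simp only [h, if_true]; fun_prop
        · simp only [h, if_false]; fun_prop
      · by_cases h : good'
        · simp only [h, if_true]; fun_prop
        · simp only [h, if_false]; fun_prop⟩
  have hQ1 : ∀ x q, (Q.1 x).1 q = if good q then x.1 q else 0 := fun _ _ => rfl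
  have hQ2 : ∀ x, (Q.1 x).2 = if good' then x.2 else 0 := fun _ => rfl
  refine ⟨Q, contEnd_ext fun x => ?_, fun x => ?_⟩
  · change Q.1 (Q.1 x) = Q.1 x
    ext q
    · rw [hQ1, hQ1]
      split_ifs <;> rfl
    · rw [hQ2, hQ2]
      split_ifs <;> rfl
  · have h₁ : Tendsto (fun n : ℕ => ((θ ^ n.factorial).1 x).1) atTop (𝓝 (Q.1 x).1) := by
      refine tendsto_pi_nhds.2 fun q => ?_
      simp only [hiter, hQ1]
      by_cases h : good q
      · simpa only [h, if_true] using h (x.1 q)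
      · simpa only [h, if_false] using
          ((((hF q).isPadicLike (hP q q.2)).dichotomy (γ q) (hγ q)).resolve_left h) (x.1 q)
    have h₂ : Tendsto (fun n : ℕ => ((θ ^ n.factorial).1 x).2) atTop (𝓝 (Q.1 x).2) := by
      simp only [hiter', hQ2]
      by_cases h : good'
      · simpa only [h, if_true] using h x.2
      · simpa only [h, if_false] using
          (((isPadicLike_quasicyclic hp).dichotomy δ continuous_of_discreteTopology).resolve_left
            h) x.2
    exact h₁.prodMk_nhds h₂

theorem exists_half_productGroup (hP : ∀ q ∈ P, q.Prime) (hP2 : 2 ∉ P)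
    (hF : ∀ q : P, IsCyclicOrPadic (q : ℕ) (F q)) (hp : p.Prime) (hp2 : p ≠ 2) :
    ∃ h : contEnd (ProductGroup F p), 2 * h = 1 := by
  have h1 : ∀ q : P, ∃ h : F q →+ F q, Continuous h ∧ ∀ x, 2 • h x = x := fun q =>
    ((hF q).isPadicLike (hP q q.2)).divide 2 ((Nat.coprime_primes Nat.prime_two (hP q q.2)).2
      fun h => hP2 (h ▸ q.2))
  choose h hc hh using h1
  obtain ⟨h', hc', hh'⟩ := (isPadicLike_quasicyclic hp).divide 2
    ((Nat.coprime_primes Nat.prime_two hp).2 hp2.symm)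
  refine ⟨⟨{ toFun := fun x => (fun q => h q (x.1 q), h' x.2)
             map_zero' := by ext <;> simp
             map_add' := fun x y => by ext <;> simp }, ?_⟩, contEnd_ext fun x => ?_⟩
  · exact (continuous_pi fun q => (hc q).comp ((continuous_apply q).comp continuous_fst)).prodMk
      (hc'.comp continuous_snd)
  · change (2 : contEnd (ProductGroup F p)).1 (fun q => h q (x.1 q), h' x.2) = x
    rw [contEnd_two_apply, ← two_nsmul]
    ext q
    · exact hh q _
    · exact hh' _

/-- The projection onto the compact factor. -/
def projCompact : contEnd (ProductGroup F p) :=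
  ⟨(AddMonoidHom.inl _ _).comp (AddMonoidHom.fst _ _),
    continuous_fst.prodMk continuous_const⟩

/-- The projection onto the quasicyclic factor. -/
def projQuasicyclic : contEnd (ProductGroup F p) :=
  ⟨(AddMonoidHom.inr _ _).comp (AddMonoidHom.snd _ _),
    continuous_const.prodMk continuous_snd⟩

/-- `H` is invariant under both projections, so it is the sum of its parts in `K` and in `ℤ(p^∞)`.
-/
theorem map_eq_add_of_closed (hP : ∀ q ∈ P, q.Prime)
    (hF : ∀ q : P, IsCyclicOrPadic (q : ℕ) (F q)) (hp : p.Prime) (hpP : p ∉ P)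
    (H : AddSubgroup (ProductGroup F p)) (hH : IsClosed (H : Set (ProductGroup F p)))
    (β : contEnd (ProductGroup F p)) :
    (H.map β.1 : Set (ProductGroup F p)) =
      (fun x => β.1 x) '' {x | x ∈ H ∧ x.2 = 0} + (fun x => β.1 x) '' {x | x ∈ H ∧ x.1 = 0} := by
  ext z
  constructor
  · rintro ⟨x, hx, rfl⟩
    refine ⟨_, ⟨(x.1, 0), ⟨apply_mem_closed_subgroup hP hF hp hpP H hH projCompact x hx, rfl⟩,
      rfl⟩, _, ⟨(0, x.2),
      ⟨apply_mem_closed_subgroup hP hF hp hpP H hH projQuasicyclic x hx, rfl⟩, rfl⟩, ?_⟩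
    change β.1 _ + β.1 _ = β.1 x
    rw [← map_add]
    simp
  · rintro ⟨_, ⟨x, hx, rfl⟩, _, ⟨y, hy, rfl⟩, rfl⟩
    exact ⟨x + y, H.add_mem hx.1 hy.1, map_add _ _ _⟩

theorem isCompact_image_compactPart (hP : ∀ q ∈ P, q.Prime)
    (hF : ∀ q : P, IsCyclicOrPadic (q : ℕ) (F q))
    (H : AddSubgroup (ProductGroup F p)) (hH : IsClosed (H : Set (ProductGroup F p)))
    (β : contEnd (ProductGroup F p)) :
    IsCompact ((fun x => β.1 x) '' {x | x ∈ H ∧ x.2 = 0}) := by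
  have : ∀ q, CompactSpace (F q) := fun q => (hF q).compactSpace (hP q q.2)
  have hc : IsCompact ((Set.univ : Set (∀ q, F q)) ×ˢ ({0} : Set (Quasicyclic p))) :=
    isCompact_univ.prod isCompact_singleton
  refine IsCompact.image (hc.of_isClosed_subset ?_ ?_) (contEnd_continuous β)
  · exact hH.inter (isClosed_singleton.preimage continuous_snd)
  · exact fun x hx => ⟨trivial, hx.2⟩

theorem fst_eq_zero_of_mem_image (hP : ∀ q ∈ P, q.Prime)
    (hF : ∀ q : P, IsCyclicOrPadic (q : ℕ) (F q)) (hp : p.Prime)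
    (β : contEnd (ProductGroup F p)) {x : ProductGroup F p} (hx : x.1 = 0) : (β.1 x).1 = 0 := by
  funext q
  obtain ⟨γ, -, hγ⟩ := exists_coordinate_endo hP hF hp β q
  rw [hγ, hx]
  exact map_zero γ

/-- The image is a compact set plus a subset of `{0} × ℤ(p^∞)`; the latter is closed because
`ℤ(p^∞)` is discrete. -/
theorem isClosed_map_productGroup (hP : ∀ q ∈ P, q.Prime)
    (hF : ∀ q : P, IsCyclicOrPadic (q : ℕ) (F q)) (hp : p.Prime) (hpP : p ∉ P)
    (H : AddSubgroup (ProductGroup F p)) (hH : IsClosed (H : Set (ProductGroup F p)))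
    (β : contEnd (ProductGroup F p)) : IsClosed (H.map β.1 : Set (ProductGroup F p)) := by
  have := polishSpace_productGroup hP hF hp
  rw [map_eq_add_of_closed hP hF hp hpP H hH β]
  refine IsClosed.add_left_of_isCompact ?_ (isCompact_image_compactPart hP hF H hH β)
  set S := (fun x => β.1 x) '' {x | x ∈ H ∧ x.1 = 0} with hS
  have hS1 : ∀ z ∈ S, z.1 = 0 := by
    rintro _ ⟨x, hx, rfl⟩
    exact fst_eq_zero_of_mem_image hP hF hp β hx.2
  have : S = {z | z.1 = 0} ∩ Prod.snd ⁻¹' (Prod.snd '' S) := by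
    ext z
    refine ⟨fun hz => ⟨hS1 z hz, z, hz, rfl⟩, ?_⟩
    rintro ⟨hz, w, hw, hwz⟩
    rwa [show z = w from Prod.ext ((show z.1 = 0 from hz).trans (hS1 w hw).symm) hwz.symm]
  rw [this]
  have hT : T2Space (∀ q, F q) := by
    have : ∀ q, PolishSpace (F q) := fun q => ((hF q).isPadicLike (hP q q.2)).polish
    infer_instance
  exact (isClosed_singleton.preimage continuous_fst).inter
    ((isClosed_discrete _).preimage continuous_snd)

theorem isPowerConvergent_productGroup (hP : ∀ q ∈ P, q.Prime)
    (hF : ∀ q : P, IsCyclicOrPadic (q : ℕ) (F q)) (hp : p.Prime) (hpP : p ∉ P) :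
    IsPowerConvergent (ProductGroup F p) where
  separates := separates_productGroup hP hF hp
  invariant := apply_mem_closed_subgroup hP hF hp hpP
  closed_map := isClosed_map_productGroup hP hF hp hpP
  exists_limit := exists_limit_productGroup hP hF hp hpP

end ProductStructure

/-! ### Torsion bounds and compactness -/

section Main

open scoped Pointwise

variable {P : Set ℕ} {F : P → Type u} [∀ q, AddCommGroup (F q)] [∀ q, TopologicalSpace (F q)]
  [∀ q, IsTopologicalAddGroup (F q)] {p : ℕ}

theorem natCast_contEnd_apply {X : Type*} [AddCommGroup X] [TopologicalSpace X]
    [IsTopologicalAddGroup X] (n : ℕ) (x : X) : (n : contEnd X).1 x = n • x := by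
  induction n with
  | zero => rw [Nat.cast_zero, zero_smul]; rfl
  | succ n ih =>
    rw [Nat.cast_succ, succ_nsmul, ← ih]
    rfl

/-- For an injective character `χ` of `ℤ(p^∞)`, `χ(p^n ·)` tends to 1 pointwise, so the
characteristic function is nonzero at one of these characters. That character is trivial on `S`, and
injectivity finishes. -/
theorem exists_pow_nsmul_eq_zero [MeasurableSpace (ProductGroup F p)]
    [BorelSpace (ProductGroup F p)] {lam : Measure (ProductGroup F p)} [IsProbabilityMeasure lam]
    {S : Set (ProductGroup F p)}
    (h : ∀ y : ContChar (ProductGroup F p), chf lam y.1 ≠ 0 → ∀ x ∈ S, y.1 x = 1) :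
    ∃ n : ℕ, ∀ x ∈ S, p ^ n • x.2 = 0 := by
  obtain ⟨χ, hχ⟩ := exists_injective_addChar_quasicyclic p
  let y : ContChar (ProductGroup F p) := ⟨χ.compAddMonoidHom (AddMonoidHom.snd _ _),
    (continuous_of_discreteTopology (f := fun s : Quasicyclic p => χ s)).comp continuous_snd⟩
  have hy : ∀ n x, (y.pull ((p ^ n : ℕ) : contEnd _)).1 x = χ (p ^ n • x.2) := fun n x => by
    rw [ContChar.pull_apply, natCast_contEnd_apply]
    rfl
  have hlim : Tendsto (fun n => chf lam (y.pull ((p ^ n : ℕ) : contEnd _)).1) atTop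
      (𝓝 (chf lam (y.pull 0).1)) := by
    refine tendsto_chf (fun n => (y.pull _).2) fun x => ?_
    refine tendsto_const_nhds.congr' ?_
    obtain ⟨k, hk⟩ := quasicyclic_torsion x.2
    filter_upwards [eventually_ge_atTop k] with n hn
    obtain ⟨d, rfl⟩ := Nat.exists_eq_add_of_le hn
    rw [hy, add_comm, pow_add, mul_smul, hk, smul_zero, AddChar.map_zero_eq_one,
      ContChar.pull_zero_apply]
  rw [chf_eq_one_of_ae (ae_of_all _ y.pull_zero_apply)] at hlim
  obtain ⟨n, hn⟩ := (hlim.eventually_ne one_ne_zero).exists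
  refine ⟨n, fun x hx => hχ ?_⟩
  rw [← hy, h _ hn x hx, AddChar.map_zero_eq_one]

theorem isCompact_of_bounded_torsion (hP : ∀ q ∈ P, q.Prime)
    (hF : ∀ q : P, IsCyclicOrPadic (q : ℕ) (F q)) (hp : p.Prime)
    {G : AddSubgroup (ProductGroup F p)} (hG : IsClosed (G : Set (ProductGroup F p)))
    (h : ∃ n : ℕ, ∀ x ∈ G, p ^ n • x.2 = 0) : IsCompact (G : Set (ProductGroup F p)) := by
  have : ∀ q, CompactSpace (F q) := fun q => (hF q).compactSpace (hP q q.2)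
  obtain ⟨n, hn⟩ := h
  have hc : IsCompact ((Set.univ : Set (∀ q, F q)) ×ˢ {s : Quasicyclic p | p ^ n • s = 0}) :=
    isCompact_univ.prod (finite_quasicyclic_torsion hp.ne_zero n).isCompact
  exact hc.of_isClosed_subset hG fun x hx => ⟨trivial, hn x hx⟩

theorem isCompact_map_of_bounded_torsion (hP : ∀ q ∈ P, q.Prime)
    (hF : ∀ q : P, IsCyclicOrPadic (q : ℕ) (F q)) (hp : p.Prime) (hpP : p ∉ P)
    {G : AddSubgroup (ProductGroup F p)} (hG : IsClosed (G : Set (ProductGroup F p)))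
    (β : contEnd (ProductGroup F p)) (h : ∃ n : ℕ, ∀ x ∈ G, p ^ n • (β.1 x).2 = 0) :
    IsCompact (G.map β.1 : Set (ProductGroup F p)) := by
  refine isCompact_of_bounded_torsion hP hF hp (isClosed_map_productGroup hP hF hp hpP G hG β) ?_
  obtain ⟨n, hn⟩ := h
  refine ⟨n, ?_⟩
  rintro _ ⟨x, hx, rfl⟩
  exact hn x hx

theorem bounded_torsion_or_prod (hP : ∀ q ∈ P, q.Prime)
    (hF : ∀ q : P, IsCyclicOrPadic (q : ℕ) (F q)) (hp : p.Prime) (hpP : p ∉ P)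
    {G : AddSubgroup (ProductGroup F p)} (hG : IsClosed (G : Set (ProductGroup F p))) :
    (∃ n : ℕ, ∀ x ∈ G, p ^ n • x.2 = 0) ∨
      ∃ M : AddSubgroup (∀ q, F q), IsCompact (M : Set (∀ q, F q)) ∧ G = M.prod ⊤ := by
  have : ∀ q, CompactSpace (F q) := fun q => (hF q).compactSpace (hP q q.2)
  have hinv := apply_mem_closed_subgroup hP hF hp hpP G hG
  rcases addSubgroup_quasicyclic hp (G.comap (AddMonoidHom.inr (∀ q, F q) (Quasicyclic p))) with
    ⟨n, hn⟩ | htop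
  · exact Or.inl ⟨n, fun x hx => hn x.2 (hinv projQuasicyclic x hx)⟩
  · refine Or.inr ⟨G.comap (AddMonoidHom.inl (∀ q, F q) (Quasicyclic p)), ?_, ?_⟩
    · exact (hG.preimage (f := fun k : ∀ q, F q => (k, (0 : Quasicyclic p)))
        (by fun_prop)).isCompact
    · ext x
      rw [AddSubgroup.mem_prod]
      refine ⟨fun hx => ⟨hinv projCompact x hx, trivial⟩, fun hx => ?_⟩
      have h1 : ((x.1, 0) : ProductGroup F p) ∈ G := hx.1
      have h2 : ((0, x.2) : ProductGroup F p) ∈ G :=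
        (htop ▸ AddSubgroup.mem_top x.2 :
          x.2 ∈ G.comap (AddMonoidHom.inr (∀ q, F q) (Quasicyclic p)))
      simpa using G.add_mem h1 h2

end Main

end HeydeAnalysis

/-! ### The theorem -/

theorem theorem3p5
    -- the group `X = K × ℤ(p^∞)`, `K = ∏_{q ∈ P} F q`
    (P : Set ℕ) (hP : ∀ q ∈ P, q.Prime) (hP2 : 2 ∉ P)
    (F : P → Type u) [∀ q, AddCommGroup (F q)] [∀ q, TopologicalSpace (F q)]
    [∀ q, IsTopologicalAddGroup (F q)] (hF : ∀ q : P, IsCyclicOrPadic (q : ℕ) (F q))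
    (p : ℕ) (hp : p.Prime) (hp2 : p ≠ 2) (hpP : p ∉ P)
    [MeasurableSpace (ProductGroup F p)] [BorelSpace (ProductGroup F p)]
    -- the automorphism, the independent random variables and their distributions
    (α : ProductGroup F p ≃ₜ+ ProductGroup F p)
    {Ω : Type v} [MeasurableSpace Ω] (Pr : Measure Ω) [IsProbabilityMeasure Pr]
    (ξ₁ ξ₂ : Ω → ProductGroup F p) (hξ₁ : Measurable ξ₁) (hξ₂ : Measurable ξ₂)
    (hind : IndepFun ξ₁ ξ₂ Pr)
    (μ₁ μ₂ : Measure (ProductGroup F p)) (hμ₁ : Pr.map ξ₁ = μ₁) (hμ₂ : Pr.map ξ₂ = μ₂)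
    (hsymm : CondSymmetric (fun ω => ξ₁ ω + ξ₂ ω) (fun ω => ξ₁ ω + α (ξ₂ ω)) Pr) :
    ∃ (G : AddSubgroup (ProductGroup F p)) (lam : Measure (ProductGroup F p)),
      IsClosed (G : Set (ProductGroup F p)) ∧
      -- (I)
      G.map (idSub α) = G ∧
      -- `lam` is a distribution supported in `G`
      IsProbabilityMeasure lam ∧ lam (G : Set (ProductGroup F p))ᶜ = 0 ∧
      -- (i)
      IsShift μ₁ lam ∧ IsShift μ₂ lam ∧
      -- (ii)
      IsMinimalSubgroup G lam ∧
      -- (II) and (iii)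
      (∃ hc : IsCompact (G.map (idAdd α) : Set (ProductGroup F p)),
        IsFactor (haarDistribution (G.map (idAdd α)) hc) lam) ∧
      -- (iv)
      (∃ hαG : G.map (α : ProductGroup F p →+ ProductGroup F p) = G,
        ∀ (Ω' : Type w) [MeasurableSpace Ω'] (Pr' : Measure Ω') [IsProbabilityMeasure Pr']
          (η₁ η₂ : Ω' → G), Measurable η₁ → Measurable η₂ → IndepFun η₁ η₂ Pr' →
          Pr'.map (fun ω => (η₁ ω : ProductGroup F p)) = lam →
          Pr'.map (fun ω => (η₂ ω : ProductGroup F p)) = lam →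
          CondSymmetric (fun ω => η₁ ω + η₂ ω)
            (fun ω => η₁ ω + restrictAut α G hαG (η₂ ω)) Pr') ∧
      -- compactness of `G` in terms of the restriction of `α` to `ℤ(p^∞)`
      ((¬ ∀ a : Quasicyclic p, α (0, a) = (0, -a)) →
        IsCompact (G : Set (ProductGroup F p))) ∧
      ((∀ a : Quasicyclic p, α (0, a) = (0, -a)) →
        IsCompact (G : Set (ProductGroup F p)) ∨
        ∃ M : AddSubgroup (∀ q, F q), IsCompact (M : Set (∀ q, F q)) ∧ G = M.prod ⊤) := by
  have := polishSpace_productGroup hP hF hp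
  have hX := isPowerConvergent_productGroup hP hF hp hpP
  let a : contEnd (ProductGroup F p) := ⟨(α : ProductGroup F p →+ ProductGroup F p), α.continuous⟩
  let b : contEnd (ProductGroup F p) :=
    ⟨(α.symm : ProductGroup F p →+ ProductGroup F p), α.symm.continuous⟩
  have hab : a * b = 1 := contEnd_ext fun x => α.apply_symm_apply x
  have hba : b * a = 1 := contEnd_ext fun x => α.symm_apply_apply x
  obtain ⟨h, hh⟩ := exists_half_productGroup hP hP2 hF hp hp2
  have hh' : h * 2 = 1 := by rw [← hh]; noncomm_ring
  -- The inverse of `4α` is `h² α⁻¹`, with `h` the inverse of 2.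
  have hc : h * h * b * (4 * a) = 1 := by
    calc h * h * b * (4 * a) = h * (h * 2) * 2 * (b * a) := by noncomm_ring
      _ = 1 := by rw [hh', mul_one, hh', hba, mul_one]
  have hc' : 4 * a * (h * h * b) = 1 := by
    calc 4 * a * (h * h * b) = a * (2 * h) * (2 * h) * b := by noncomm_ring
      _ = 1 := by rw [hh, mul_one, mul_one, hab]
  subst hμ₁ hμ₂
  have := Measure.isProbabilityMeasure_map (μ := Pr) hξ₁.aemeasurable
  have := Measure.isProbabilityMeasure_map (μ := Pr) hξ₂.aemeasurable
  have H : HeydeLaw a.1 (Pr.map ξ₁) (Pr.map ξ₂) := HeydeLaw.of_condSymmetric hξ₁ hξ₂ hind hsymm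
  obtain ⟨G, lam, hGc, hlam, hlamG, hs₁, hs₂, hmin, hGmap, Hlam, htriv⟩ :=
    exists_common_shift hX hc hc' H
  have htriv' : ∀ y : ContChar (ProductGroup F p), chf lam y.1 ≠ 0 →
      ∀ x ∈ (G.map (idAdd α) : Set (ProductGroup F p)), y.1 x = 1 := by
    rintro y hy _ ⟨x, hx, rfl⟩
    exact htriv y hy x hx
  obtain ⟨n, hn⟩ := exists_pow_nsmul_eq_zero htriv'
  have hn' : ∀ x ∈ G, p ^ n • ((1 + a).1 x).2 = 0 := fun x hx => hn _ ⟨x, hx, rfl⟩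
  have hcomp : IsCompact (G.map (idAdd α) : Set (ProductGroup F p)) :=
    isCompact_map_of_bounded_torsion hP hF hp hpP hGc (1 + a) ⟨n, hn'⟩
  have hαG : G.map (α : ProductGroup F p →+ ProductGroup F p) = G := by
    apply le_antisymm
    · rintro _ ⟨x, hx, rfl⟩
      exact hX.invariant G hGc a x hx
    · intro x hx
      exact ⟨_, hX.invariant G hGc b x hx, α.apply_symm_apply x⟩
  refine ⟨G, lam, hGc, hGmap, hlam, hlamG, hs₁, hs₂, hmin,
    ⟨hcomp, isFactor_haarDistribution hX _ hcomp htriv'⟩, ⟨hαG, ?_⟩, ?_, ?_⟩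
  · intro Ω' _ Pr' _ η₁ η₂ hη₁ hη₂ hη hl₁ hl₂
    have hαm : Measurable (restrictAut α G hαG) :=
      (restrictAut α G hαG).continuous.measurable
    have hm₁ : Measurable fun ω => (η₁ ω : ProductGroup F p) := measurable_subtype_coe.comp hη₁
    have hm₂ : Measurable fun ω => (η₂ ω : ProductGroup F p) := measurable_subtype_coe.comp hη₂
    have hadd : ∀ {ζ : Ω' → G}, Measurable ζ → Measurable fun ω => η₁ ω + ζ ω := fun {ζ} hζ =>
      (hm₁.add (measurable_subtype_coe.comp hζ)).subtype_mk
    refine CondSymmetric.of_coe hGc.measurableSet (hadd hη₂) (hadd (hαm.comp hη₂)) ?_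
    exact HeydeLaw.condSymmetric (a := a) hm₁ hm₂
      (hη.comp measurable_subtype_coe measurable_subtype_coe) (by rw [hl₁, hl₂]; exact Hlam)
  · intro hα
    rcases bounded_torsion_or_prod hP hF hp hpP hGc with hb | ⟨M, -, hM⟩
    · exact isCompact_of_bounded_torsion hP hF hp hGc hb
    · refine absurd (fun s => ?_) hα
      -- Here `G` contains `ℤ(p^∞)`, so `p^n (1+α)` vanishes there. Divisibility by `p^n` removes
      -- the factor and gives `α = -I` on `ℤ(p^∞)`.
      obtain ⟨t, rfl⟩ := exists_pow_nsmul_eq_quasicyclic hp.ne_zero n s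
      have hmem : ((0, t) : ProductGroup F p) ∈ G := by
        rw [hM]
        exact ⟨M.zero_mem, trivial⟩
      have h1 : p ^ n • ((1 + a).1 (0, t)).2 = 0 := hn' _ hmem
      have h2 : p ^ n • (t + (α (0, t)).2) = 0 := h1
      have h3 : ((0, p ^ n • t) : ProductGroup F p) = p ^ n • (0, t) := by simp
      refine Prod.ext (fst_eq_zero_of_mem_image hP hF hp a rfl) ?_
      rw [smul_add] at h2
      rw [h3, map_nsmul, Prod.smul_snd]
      exact (neg_eq_of_add_eq_zero_right h2).symm
  · intro _
    exact (bounded_torsion_or_prod hP hF hp hpP hGc).imp_left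
      (isCompact_of_bounded_torsion hP hF hp hGc)
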